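/- **Proposition (CCR preserved by the Langevin equation).** Let $m_S,m_E,g,t_0\in\mathbb R$, signature $(+,-,-,-)$, $\Box=\partial_0^2-\nabla^2$, $\hbar=c=1$. Let $\phi_S,\phi_E$ be hermitian scalar quantum fields on $\mathbb R\times\mathbb R^3$, given at sharp times as operator-valued tempered distributions in space on a common invariant dense domain $D$, with $\pi_X=\partial_0\phi_X$; the matrix elements between vectors of $D$ of $\phi_X(t,f)$ and $\pi_X(t,f)$, $f\in\mathcal S(\mathbb R^3)$, are jointly continuous in $(t,f)$ and satisfy (in the sense of derivatives of these matrix elements) the Heisenberg equations of motion $$(\Box+m_S^2)\phi_S=-g\,\phi_E,\qquad(\Box+m_E^2)\phi_E=-g\,\phi_S .$$ On the one surface $\Sigma_0=\{x^0=t_0\}$ assume the canonical equal-time commutation relations: $[\phi_X(\mathbf x),\pi_X(\mathbf y)]=i\delta^{(3)}(\mathbf x-\mathbf y)$, $[\phi_X(\mathbf x),\phi_X(\mathbf y)]=[\pi_X(\mathbf x),\pi_X(\mathbf y)]=0$ for $X=S,E$, and the Cauchy data $\phi_S,\pi_S$ commute with $\phi_E,\pi_E$. Let $\Delta_E^R$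 be the retarded Green function of $\Box+m_E^2$, $\Gamma:=-g^2\Delta_E^R$, let $\phi_E^{\rm in}$ be the free field of mass $m_E$ with the same Cauchy data on $\Sigma_0$ as $\phi_E$, and $\xi:=-g\,\phi_E^{\rm in}$. Then: 1. For $x^0\ge t_0$ the system field satisfies the Langevin equation $$(\Box+m_S^2)\phi_S(x)+\int_{z^0\ge t_0}d^4z\,\Gamma(x-z)\,\phi_S(z)=\xi(x).$$ 2. The commutator is a c-number, $i[\phi_S(x),\phi_S(y)]=\Delta_S(x,y)\,\mathbf 1$, where $\Delta_S$ is defined for all $x^0,y^0\in\mathbb R$, and for every $y^0$ it solves, for $x^0\ge y^0$, the homogeneous causal Volterra equation $$(\Box_x+m_S^2)\Delta_S(x,y)+\int_{y^0\le z^0\le x^0}d^4z\,\Gamma(x-z)\,\Delta_S(z,y)=0,\qquad \Delta_S|_{x^0=y^0}=0,\quad \partial_{x^0}\Delta_S|_{x^0=y^0}=\delta^{(3)}(\mathbf x-\mathbf y).$$ 3. This initial value problem has a unique solution: for every $y^0$, and every $h\in\mathcal S(\mathbb R^3)$ with which $\mathbf y$ is smeared, any solution on $x^0\ge y^0$ that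 is $C^2$ in time (when smeared in $\mathbf x$) with values in the tempered distributions on $\mathbb R^3$, jointly continuous in time and test function together with its first time derivative, coincides with $\Delta_S$ there. The solution is causal: $\Delta_S(x,y)=0$ for spacelike separated $x,y$, so that for $x^0\ge y^0$ it is supported in the closed forward light cone of $y$. 4. The canonical commutation relations of the system hold at all times: for every $t\in\mathbb R$, $[\phi_S(t,\mathbf x),\phi_S(t,\mathbf y)]=[\pi_S(t,\mathbf x),\pi_S(t,\mathbf y)]=0$ and $[\phi_S(t,\mathbf x),\pi_S(t,\mathbf y)]=i\delta^{(3)}(\mathbf x-\mathbf y)$. -/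

import Mathlib

open MeasureTheory Set
open scoped SchwartzMap InnerProductSpace Laplacian

noncomputable section

namespace LangevinCCR

/-- Physical space `ℝ³`; Minkowski spacetime is `ℝ × Space`, with `□ = ∂₀² - Δ`. -/
abbrev Space : Type := EuclideanSpace ℝ (Fin 3)

/-- The spatial part `f ↦ (Δ - m²) f` of the Klein-Gordon operator:
`(□ + m²) u = 0` reads `∂₀² u = (Δ - m²) u`. -/
def kgSpatial (m : ℝ) (f : 𝓢(Space, ℂ)) : 𝓢(Space, ℂ) :=
  Δ f - ((m : ℂ) ^ 2) • f

/-- The frequency `ω(k) = √((2π|k|)² + m²)` of a plane wave `exp (2πi k·x)` of mass `m`. -/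
def freq (m : ℝ) (k : Space) : ℝ :=
  Real.sqrt ((2 * Real.pi * ‖k‖) ^ 2 + m ^ 2)

/-- The operator `cos (τ ω)` on Schwartz functions, `ω = √(m² - Δ)`. -/
def kgCos (m τ : ℝ) : 𝓢(Space, ℂ) →L[ℂ] 𝓢(Space, ℂ) :=
  SchwartzMap.fourierMultiplierCLM ℂ (fun k : Space => ((Real.cos (τ * freq m k) : ℝ) : ℂ))

/-- The operator `sin (τ ω) / ω` on Schwartz functions, `ω = √(m² - Δ)`. The symbol is written
with `sinc y = sin y / y`, `sinc 0 = 1`, so that it is smooth in `k` also for `m = 0`. -/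
def kgSin (m τ : ℝ) : 𝓢(Space, ℂ) →L[ℂ] 𝓢(Space, ℂ) :=
  SchwartzMap.fourierMultiplierCLM ℂ
    (fun k : Space => ((τ * Real.sinc (τ * freq m k) : ℝ) : ℂ))

/-- The retarded Green function `θ(τ) sin (τ ω) / ω` of `□ + m²`, at time `τ`, as the operator of
spatial convolution with `Δ^R(τ, ·)`. This kernel is even in space, so
`∫ (∫ Δ^R(τ, x - z) u(z) dz) f(x) dx = ∫ u(z) (retardedGreen m τ f)(z) dz`. -/
def retardedGreen (m τ : ℝ) : 𝓢(Space, ℂ) →L[ℂ] 𝓢(Space, ℂ) :=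
  if 0 ≤ τ then kgSin m τ else 0

/-- The memory kernel `Γ = - g² Δ_E^R`. The sign is the one that elimination of the environment
produces: `(□ + m_S²) φ_S = - g φ_E` and `φ_E = φ_E^in - g Δ_E^R * φ_S` give
`(□ + m_S²) φ_S - g² Δ_E^R * φ_S = - g φ_E^in`. -/
def memoryKernel (mE g τ : ℝ) : 𝓢(Space, ℂ) →L[ℂ] 𝓢(Space, ℂ) :=
  (-(g : ℂ) ^ 2) • retardedGreen mE τ

/-- A hermitian scalar quantum field `φ` with its velocity `π = ∂₀ φ`, smeared in space with
Schwartz functions at sharp times: `field t f = ∫ φ(t, x) f(x) dx`. The operators act on the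
pre-Hilbert space `D`, the common invariant dense domain in the Hilbert space (its completion).
Continuity and derivatives are those of matrix elements between vectors of `D`. -/
structure ScalarField (D : Type*) [NormedAddCommGroup D] [InnerProductSpace ℂ D] where
  field : ℝ → 𝓢(Space, ℂ) →ₗ[ℂ] Module.End ℂ D
  momentum : ℝ → 𝓢(Space, ℂ) →ₗ[ℂ] Module.End ℂ D
  symmetric : ∀ (t : ℝ) (f : 𝓢(Space, ℂ)), (∀ x, (f x).im = 0) → (field t f).IsSymmetric
  continuous_field : ∀ u v : D,
    Continuous fun q : ℝ × 𝓢(Space, ℂ) => ⟪u, field q.1 q.2 v⟫_ℂ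
  continuous_momentum : ∀ u v : D,
    Continuous fun q : ℝ × 𝓢(Space, ℂ) => ⟪u, momentum q.1 q.2 v⟫_ℂ
  hasDerivAt_field : ∀ (u v : D) (f : 𝓢(Space, ℂ)) (t : ℝ),
    HasDerivAt (fun s => ⟪u, field s f v⟫_ℂ) ⟪u, momentum t f v⟫_ℂ t

section
variable {D : Type*} [NormedAddCommGroup D] [InnerProductSpace ℂ D]

/-- The canonical commutation relations on the surface `x⁰ = t`:
`[φ(t,x), φ(t,y)] = 0 = [π(t,x), π(t,y)]` and `[φ(t,x), π(t,y)] = i δ³(x - y)`. -/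
structure EqualTimeCCR (A : ScalarField D) (t : ℝ) : Prop where
  field_field : ∀ f h, ⁅A.field t f, A.field t h⁆ = 0
  momentum_momentum : ∀ f h, ⁅A.momentum t f, A.momentum t h⁆ = 0
  field_momentum : ∀ f h : 𝓢(Space, ℂ),
    ⁅A.field t f, A.momentum t h⁆ = (Complex.I * ∫ x, f x * h x) • (1 : Module.End ℂ D)

/-- The Cauchy data of the two fields on the surface `x⁰ = t` commute with each other. -/
structure EqualTimeCommute (A B : ScalarField D) (t : ℝ) : Prop where
  field_field : ∀ f h, ⁅A.field t f, B.field t h⁆ = 0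
  field_momentum : ∀ f h, ⁅A.field t f, B.momentum t h⁆ = 0
  momentum_field : ∀ f h, ⁅A.momentum t f, B.field t h⁆ = 0
  momentum_momentum : ∀ f h, ⁅A.momentum t f, B.momentum t h⁆ = 0

/-- The equation of motion `(□ + m²) φ = - g χ`. -/
def SatisfiesKG (m g : ℝ) (φ χ : ScalarField D) : Prop :=
  ∀ (u v : D) (f : 𝓢(Space, ℂ)) (t : ℝ),
    HasDerivAt (fun s => ⟪u, φ.momentum s f v⟫_ℂ)
      (⟪u, φ.field t (kgSpatial m f) v⟫_ℂ - (g : ℂ) * ⟪u, χ.field t f v⟫_ℂ) t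

/-- The canonically quantized model with Lagrangian density
`½(∂φ_S)² - ½ m_S² φ_S² + ½(∂φ_E)² - ½ m_E² φ_E² - g φ_S φ_E`: Heisenberg equations of motion, and
the canonical commutation relations of system and environment on the one surface `x⁰ = t₀`. -/
structure CoupledModel (mS mE g t₀ : ℝ) (S E : ScalarField D) : Prop where
  eom_system : SatisfiesKG mS g S E
  eom_environment : SatisfiesKG mE g E S
  ccr_system : EqualTimeCCR S t₀
  ccr_environment : EqualTimeCCR E t₀
  commute : EqualTimeCommute S E t₀

/-- The free environment field `φ_E^in` of mass `mE` whose Cauchy data on `x⁰ = t₀` are those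
of `φ_E`. -/
def inField (mE t₀ : ℝ) (E : ScalarField D) (t : ℝ) (f : 𝓢(Space, ℂ)) : Module.End ℂ D :=
  E.field t₀ (kgCos mE (t - t₀) f) + E.momentum t₀ (kgSin mE (t - t₀) f)

/-- The noise operator `ξ = - g φ_E^in`. -/
def noise (mE g t₀ : ℝ) (E : ScalarField D) (t : ℝ) (f : 𝓢(Space, ℂ)) : Module.End ℂ D :=
  (-(g : ℂ)) • inField mE t₀ E t f

/-- The Heisenberg-Langevin equation `(□ + m_S²) φ_S + ∫ Γ(x - z) φ_S(z) d⁴z = ξ` to the future of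
the initial surface `x⁰ = t₀`, with memory starting there. -/
def SatisfiesLangevin (mS mE g t₀ : ℝ) (S E : ScalarField D) : Prop :=
  ∀ (u v : D) (f : 𝓢(Space, ℂ)) (t : ℝ), t₀ ≤ t →
    HasDerivAt (fun s => ⟪u, S.momentum s f v⟫_ℂ)
      (⟪u, S.field t (kgSpatial mS f) v⟫_ℂ
        - (∫ r in Ici t₀, ⟪u, S.field r (memoryKernel mE g (t - r) f) v⟫_ℂ)
        + ⟪u, noise mE g t₀ E t f v⟫_ℂ) t

end

/-- The initial value problem on `x⁰ ≥ t` for the homogeneous causal Volterra equation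
`(□ + m_S²) w + Γ * w = 0` with data `w = 0`, `∂₀ w = δ³(x - y)` at `x⁰ = t`. Here
`w s f = ∫∫ w((s, x), (t, y)) f(x) h(y) dx dy`: the second point `y` lies on the surface `y⁰ = t`
and is smeared with `h`. The values of `w` enter only at times `≥ t`: in the convolution `w` is
taken to vanish before `t`, while `Γ` vanishes at negative times, so the memory integral runs over
`t ≤ z⁰ ≤ s`. The function `w` is `C²` in time with values in the tempered distributions. -/
def IsCausalVolterraSolution (mS mE g t : ℝ) (h : 𝓢(Space, ℂ)) (w : ℝ → 𝓢'(Space, ℂ)) : Prop :=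
  ∃ p : ℝ → 𝓢'(Space, ℂ),
    ContinuousOn (fun q : ℝ × 𝓢(Space, ℂ) => w q.1 q.2) (Ici t ×ˢ univ) ∧
    ContinuousOn (fun q : ℝ × 𝓢(Space, ℂ) => p q.1 q.2) (Ici t ×ˢ univ) ∧
    (∀ (f : 𝓢(Space, ℂ)) (s : ℝ), t ≤ s →
      HasDerivWithinAt (fun r => w r f) (p s f) (Ici t) s) ∧
    (∀ (f : 𝓢(Space, ℂ)) (s : ℝ), t ≤ s →
      HasDerivWithinAt (fun r => p r f)
        (w s (kgSpatial mS f) - ∫ r in Ici t, w r (memoryKernel mE g (s - r) f)) (Ici t) s) ∧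
    (∀ f : 𝓢(Space, ℂ), w t f = 0) ∧
    (∀ f : 𝓢(Space, ℂ), p t f = ∫ x, f x * h x)

/-- Causal support of a bidistribution `K((s, x), (t, y))`, smeared as `K s t h f` with `f(x)` and
`h(y)`: it vanishes at spacelike separated points `(s, x)`, `(t, y)`. Thus for `s ≥ t` its support
is in the closed forward light cone of `(t, y)`. -/
def CausallySupported (K : ℝ → ℝ → 𝓢(Space, ℂ) →L[ℂ] 𝓢'(Space, ℂ)) : Prop :=
  ∀ (s t : ℝ) (f h : 𝓢(Space, ℂ)),
    (∀ x ∈ tsupport f, ∀ y ∈ tsupport h, |s - t| < dist x y) → K s t h f = 0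

end LangevinCCR

end

noncomputable section

namespace LangevinCCR
open Filter Topology FourierTransform LineDeriv

/-! The coupling is bilinear, so the model is a free theory in disguise. A rotation of the pair
(system, environment) diagonalizes the mass matrix `[[mS², g], [g, mE²]]` (`exists_massRotation`),
and each normal mode is a free Klein-Gordon field with squared mass `μ₁` or `μ₂`. An eigenvalue may
be negative; the propagators are therefore built from the entire functions cos √y and sinc √y of a
real variable `y`, which makes sense of cos(τω) and sin(τω)/ω for every real ω².

Everything about the evolution rests on Duhamel's formula, `WeakKG.duhamel`. Without source, it
expresses a mode through its Cauchy data. As rotations preserve canonical commutators and free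
evolution does too (`CrossCCR.evolve`), the system keeps its commutation relations, and its
commutator is the c-number kernel α² sin(τω₁)/ω₁ + β² sin(τω₂)/ω₂ (`CrossCCR.commutator`). With the
system as source, the same formula eliminates the environment and gives the Langevin equation.
Applied to the mixed kernel αβ (sin(τω₁)/ω₁ - sin(τω₂)/ω₂), which has vanishing Cauchy data, it
gives the Volterra equation (`MassRotation.isCausalVolterraSolution`).

Uniqueness is a duality argument (`MassRotation.eq_zero_of_memory`): a solution with zero data is
paired with the explicit kernel run backwards in time. The two memory terms that arise are integrals
of one function over the same triangle and cancel by Fubini.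

Causality is finite propagation speed for a single mode (`propSin_eq_zero`). The energy weighted by
exp(-2η|x - c|) grows at most at the rate 2η + |1 - μ|; letting η grow confines the solution to the
light cone, whatever the sign of `μ`. -/

/-! ### Stumpff functions -/

/-- The Stumpff function `∑ (-y)^j / (2j + n)!`; for `n = 0, 1` it is `cos √y` and `sinc √y`. -/
def stumpff (n : ℕ) (y : ℝ) : ℝ := ∑' j : ℕ, (-1) ^ j / ((2 * j + n).factorial : ℝ) * y ^ j

lemma factorial_inv_le (n j : ℕ) :
    1 / ((2 * j + n).factorial : ℝ) ≤ 1 / (j.factorial : ℝ) := by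
  apply one_div_le_one_div_of_le (by positivity)
  exact_mod_cast Nat.factorial_le (by omega)

lemma summable_stumpff (n : ℕ) (y : ℝ) :
    Summable fun j : ℕ => (-1) ^ j / ((2 * j + n).factorial : ℝ) * y ^ j := by
  refine .of_norm_bounded (Real.summable_pow_div_factorial |y|) fun j => ?_
  rw [norm_mul, norm_div, norm_pow, norm_pow, norm_neg, norm_one, one_pow, Real.norm_eq_abs y,
    Real.norm_of_nonneg (by positivity)]
  calc _ ≤ 1 / (j.factorial : ℝ) * |y| ^ j := by gcongr ?_ * _; exact factorial_inv_le n j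
    _ = _ := by ring

/-- Splitting off the term `j = 0` raises the index by two. The relation carries bounds from `n` to
`n + 2` at large `y`, and in operator form it gives the behaviour of the propagators at small times.
-/
lemma stumpff_recurrence (n : ℕ) (y : ℝ) :
    stumpff n y = 1 / (n.factorial : ℝ) - y * stumpff (n + 2) y := by
  rw [stumpff, (summable_stumpff n y).tsum_eq_zero_add, stumpff, ← tsum_mul_left, sub_eq_add_neg,
    ← tsum_neg]
  congr 1
  · simp
  · refine tsum_congr fun j => ?_
    rw [show 2 * (j + 1) + n = 2 * j + (n + 2) by ring]
    ring

/-- Differentiate termwise and write 2(j + 1) = (2j + n + 2) - n. The family is thus closed under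
differentiation, so bounds on all derivatives reduce to bounds on the functions themselves. -/
lemma hasDerivAt_stumpff (n : ℕ) (y : ℝ) :
    HasDerivAt (stumpff n) (-(1 / 2) * (stumpff (n + 1) y - n * stumpff (n + 2) y)) y := by
  -- A ball around `0` that contains `y`. Since `1 ≤ R`, the bound `R ^ (j - 1) ≤ R ^ j` holds also
  -- at `j = 0`, where the subtraction is truncated.
  set R : ℝ := |y| + 1 with hR
  have hR1 : 1 ≤ R := by simp [hR]
  have hd : ∀ (j : ℕ) (x : ℝ), HasDerivAt (fun x => (-1) ^ j / ((2 * j + n).factorial : ℝ) * x ^ j)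
      ((-1) ^ j / ((2 * j + n).factorial : ℝ) * (j * x ^ (j - 1))) x :=
    fun j x => (hasDerivAt_pow j x).const_mul _
  have hb : ∀ (j : ℕ) (x : ℝ), x ∈ Metric.ball (0 : ℝ) R →
      ‖(-1) ^ j / ((2 * j + n).factorial : ℝ) * (j * x ^ (j - 1))‖ ≤ (2 * R) ^ j / j.factorial := by
    intro j x hx
    have hx' : |x| ≤ R := by simpa using (mem_ball_zero_iff.1 hx).le
    rw [norm_mul, norm_mul, norm_div, norm_pow, norm_pow, norm_neg, norm_one, one_pow,
      Real.norm_eq_abs x, Real.norm_of_nonneg (by positivity), Real.norm_of_nonneg (by positivity)]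
    calc _ ≤ 1 / (j.factorial : ℝ) * (2 ^ j * R ^ j) := by
          gcongr ?_ * (?_ * ?_)
          · exact factorial_inv_le n j
          · exact_mod_cast Nat.lt_two_pow_self.le
          · calc |x| ^ (j - 1) ≤ R ^ (j - 1) := by gcongr
              _ ≤ R ^ j := pow_le_pow_right₀ hR1 (by omega)
      _ = _ := by rw [mul_pow]; ring
  have hy : y ∈ Metric.ball (0 : ℝ) R := by simp [hR]
  have hmain := hasDerivAt_tsum_of_isPreconnected (Real.summable_pow_div_factorial (2 * R))
    Metric.isOpen_ball (convex_ball (0 : ℝ) R).isPreconnected (fun j x _ => hd j x) hb hy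
    (summable_stumpff n y) hy
  have hs : Summable fun j : ℕ => (-1) ^ j / ((2 * j + n).factorial : ℝ) * (j * y ^ (j - 1)) :=
    .of_norm_bounded (Real.summable_pow_div_factorial (2 * R)) fun j => hb j y hy
  refine hmain.congr_deriv ?_
  symm
  rw [hs.tsum_eq_zero_add, stumpff, stumpff, ← tsum_mul_left,
    ← (summable_stumpff (n + 1) y).tsum_sub ((summable_stumpff (n + 2) y).mul_left _),
    ← tsum_mul_left]
  simp only [Nat.cast_zero, zero_mul, mul_zero, zero_add]
  refine tsum_congr fun j => ?_
  rw [show 2 * (j + 1) + n = 2 * j + n + 1 + 1 by ring, show 2 * j + (n + 2) = 2 * j + n + 1 + 1 by ring,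
    show 2 * j + (n + 1) = 2 * j + n + 1 by ring, Nat.factorial_succ (2 * j + n + 1)]
  have h1 : ((2 * j + n + 1).factorial : ℝ) ≠ 0 := by positivity
  have h2 : ((2 * j + n + 1 + 1 : ℕ) : ℝ) ≠ 0 := by positivity
  push_cast at h2 ⊢
  field_simp
  ring

lemma deriv_stumpff (n : ℕ) :
    deriv (stumpff n) = fun y => -(1 / 2) * (stumpff (n + 1) y - n * stumpff (n + 2) y) :=
  funext fun y => (hasDerivAt_stumpff n y).deriv

lemma contDiff_stumpff (m n : ℕ) : ContDiff ℝ m (stumpff n) := by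
  induction m generalizing n with
  | zero =>
    exact contDiff_zero.2 (continuous_iff_continuousAt.2 fun y =>
      (hasDerivAt_stumpff n y).continuousAt)
  | succ m ih =>
    push_cast
    rw [contDiff_succ_iff_deriv]
    refine ⟨fun y => (hasDerivAt_stumpff n y).differentiableAt, by simp, ?_⟩
    rw [deriv_stumpff]
    exact contDiff_const.mul ((ih _).sub (contDiff_const.mul (ih _)))

lemma continuous_stumpff (n : ℕ) : Continuous (stumpff n) := (contDiff_stumpff 0 n).continuous

lemma stumpff_zero_right (n : ℕ) : stumpff n 0 = 1 / (n.factorial : ℝ) := by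
  rw [stumpff_recurrence]; simp

lemma stumpff_zero_sq (x : ℝ) : stumpff 0 (x ^ 2) = Real.cos x := by
  rw [← (Real.hasSum_cos x).tsum_eq, stumpff]
  refine tsum_congr fun j => ?_
  rw [add_zero, pow_mul]; ring

lemma stumpff_one_sq (x : ℝ) : stumpff 1 (x ^ 2) = Real.sinc x := by
  by_cases hx : x = 0
  · simp [hx, stumpff_zero_right]
  rw [Real.sinc_of_ne_zero hx, ← (Real.hasSum_sin x).tsum_eq, stumpff, ← tsum_div_const]
  refine tsum_congr fun j => ?_
  rw [← pow_mul]
  field_simp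
  rw [pow_succ]

/-- For `y ≥ 1` the cases `n = 0, 1` are cos and sinc, and the recurrence bounds `y * stumpff (n +
2) y`, hence `stumpff (n + 2) y`. On `[-R, 1]` compactness suffices. The lower cut-off is needed
because cos √y grows as `y → -∞`. -/
lemma stumpff_bounded (R : ℝ) (n : ℕ) : ∃ C, ∀ y, -R ≤ y → |stumpff n y| ≤ C := by
  have key : ∀ n, (∃ C, ∀ y, 1 ≤ y → |stumpff n y| ≤ C) →
      ∃ C, ∀ y, -R ≤ y → |stumpff n y| ≤ C := by
    rintro n ⟨C, hC⟩
    obtain ⟨C', hC'⟩ := isCompact_Icc.exists_bound_of_continuousOn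
      (continuous_stumpff n).continuousOn (s := Icc (-R) 1)
    refine ⟨max C C', fun y hy => ?_⟩
    rcases le_total 1 y with h | h
    · exact (hC y h).trans (le_max_left _ _)
    · exact (hC' y ⟨hy, h⟩).trans (le_max_right _ _)
  refine key n ?_
  induction n using Nat.twoStepInduction with
  | zero =>
    refine ⟨1, fun y hy => ?_⟩
    rw [← Real.sq_sqrt (zero_le_one.trans hy), stumpff_zero_sq]
    exact Real.abs_cos_le_one _
  | one =>
    refine ⟨1, fun y hy => ?_⟩
    rw [← Real.sq_sqrt (zero_le_one.trans hy), stumpff_one_sq]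
    exact Real.abs_sinc_le_one _
  | more n ih _ =>
    obtain ⟨C, hC⟩ := ih
    refine ⟨1 / (n.factorial : ℝ) + C, fun y hy => ?_⟩
    have h := stumpff_recurrence n y
    have h1 : |y * stumpff (n + 2) y| ≤ 1 / (n.factorial : ℝ) + C := by
      rw [show y * stumpff (n + 2) y = 1 / (n.factorial : ℝ) - stumpff n y by linarith]
      refine (abs_sub _ _).trans (add_le_add (abs_of_nonneg (by positivity)).le (hC y hy))
    rw [abs_mul, abs_of_nonneg (zero_le_one.trans hy)] at h1
    nlinarith [abs_nonneg (stumpff (n + 2) y)]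

lemma iteratedDeriv_stumpff_bounded (R : ℝ) (m n : ℕ) :
    ∃ C, ∀ y, -R ≤ y → |iteratedDeriv m (stumpff n) y| ≤ C := by
  induction m generalizing n with
  | zero => simpa using stumpff_bounded R n
  | succ m ih =>
    obtain ⟨C₁, h₁⟩ := ih (n + 1)
    obtain ⟨C₂, h₂⟩ := ih (n + 2)
    refine ⟨1 / 2 * (C₁ + n * C₂), fun y hy => ?_⟩
    have hc := fun k => (contDiff_stumpff m k).contDiffAt (x := y)
    rw [iteratedDeriv_succ', deriv_stumpff, iteratedDeriv_const_mul_field,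
      iteratedDeriv_fun_sub (hc _) (contDiffAt_const.mul (hc _)),
      iteratedDeriv_const_mul_field, abs_mul]
    have := abs_sub (iteratedDeriv m (stumpff (n + 1)) y) (n * iteratedDeriv m (stumpff (n + 2)) y)
    rw [abs_mul, Nat.abs_cast] at this
    have h3 : (n : ℝ) * |iteratedDeriv m (stumpff (n + 2)) y| ≤ n * C₂ := by gcongr; exact h₂ y hy
    norm_num
    linarith [h₁ y hy]

lemma iteratedFDeriv_stumpff_bounded (R : ℝ) (N n : ℕ) :
    ∃ C, ∀ m ≤ N, ∀ y, -R ≤ y → ‖iteratedFDeriv ℝ m (stumpff n) y‖ ≤ C := by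
  choose C hC using fun m => iteratedDeriv_stumpff_bounded R m n
  refine ⟨∑ m ∈ Finset.range (N + 1), |C m|, fun m hm y hy => ?_⟩
  rw [norm_iteratedFDeriv_eq_norm_iteratedDeriv]
  exact ((hC m y hy).trans (le_abs_self _)).trans
    (Finset.single_le_sum (f := fun m => |C m|) (fun _ _ => abs_nonneg _)
      (Finset.mem_range.2 (by omega)))

/-! ### The scalar oscillator `q'' = - L q` with arbitrary real `L` -/

/-- `cos (τ √L)`, continued analytically to all real `L`. -/
def oscCos (L τ : ℝ) : ℝ := stumpff 0 (τ ^ 2 * L)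

/-- `sin (τ √L) / √L`, continued analytically to all real `L`. -/
def oscSin (L τ : ℝ) : ℝ := τ * stumpff 1 (τ ^ 2 * L)

lemma hasDerivAt_oscCos (L τ : ℝ) : HasDerivAt (oscCos L) (-(L * oscSin L τ)) τ := by
  have h := (hasDerivAt_stumpff 0 (τ ^ 2 * L)).comp τ ((hasDerivAt_pow 2 τ).mul_const L)
  refine h.congr_deriv ?_
  simp only [oscSin, Nat.cast_zero, zero_mul, zero_add]
  push_cast
  ring

lemma hasDerivAt_oscSin (L τ : ℝ) : HasDerivAt (oscSin L) (oscCos L τ) τ := by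
  have h := (hasDerivAt_id τ).mul
    ((hasDerivAt_stumpff 1 (τ ^ 2 * L)).comp τ ((hasDerivAt_pow 2 τ).mul_const L))
  refine h.congr_deriv ?_
  -- The chain rule leaves Stumpff functions of index 1, 2 and 3; the recurrences at 0 and 1
  -- eliminate the last two.
  have h0 := stumpff_recurrence 0 (τ ^ 2 * L)
  have h1 := stumpff_recurrence 1 (τ ^ 2 * L)
  simp only [oscCos, id, Function.comp_apply, Nat.factorial, Nat.cast_one] at *
  norm_num at *
  linear_combination (-1) * h0 + h1

@[simp] lemma oscCos_zero (L : ℝ) : oscCos L 0 = 1 := by simp [oscCos, stumpff_zero_right]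
@[simp] lemma oscSin_zero (L : ℝ) : oscSin L 0 = 0 := by simp [oscSin]
@[simp] lemma oscCos_neg (L τ : ℝ) : oscCos L (-τ) = oscCos L τ := by simp [oscCos]
@[simp] lemma oscSin_neg (L τ : ℝ) : oscSin L (-τ) = -oscSin L τ := by simp [oscSin]

/-- With `a` replaced by `a + b - r` and `b` by `r`, the right side does not depend on `r`; compare
`r = 0` with `r = b`. -/
lemma oscCos_add (L a b : ℝ) :
    oscCos L (a + b) = oscCos L a * oscCos L b - L * (oscSin L a * oscSin L b) := by
  have h : ∀ r, HasDerivAt (fun r => oscCos L (a + b - r) * oscCos L r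
      - L * (oscSin L (a + b - r) * oscSin L r)) 0 r := by
    intro r
    have hr : HasDerivAt (fun r => a + b - r) (-1) r := (hasDerivAt_id r).const_sub _
    have hc := (hasDerivAt_oscCos L (a + b - r)).comp r hr
    have hs := (hasDerivAt_oscSin L (a + b - r)).comp r hr
    refine ((hc.mul (hasDerivAt_oscCos L r)).sub
      ((hs.mul (hasDerivAt_oscSin L r)).const_mul L)).congr_deriv ?_
    simp only [Function.comp_apply]
    ring
  have := is_const_of_deriv_eq_zero (fun r => (h r).differentiableAt) (fun r => (h r).deriv) 0 b
  simpa using this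

lemma oscSin_add (L a b : ℝ) :
    oscSin L (a + b) = oscSin L a * oscCos L b + oscCos L a * oscSin L b := by
  have h : ∀ r, HasDerivAt (fun r => oscSin L (a + b - r) * oscCos L r
      + oscCos L (a + b - r) * oscSin L r) 0 r := by
    intro r
    have hr : HasDerivAt (fun r => a + b - r) (-1) r := (hasDerivAt_id r).const_sub _
    have hc := (hasDerivAt_oscCos L (a + b - r)).comp r hr
    have hs := (hasDerivAt_oscSin L (a + b - r)).comp r hr
    refine ((hs.mul (hasDerivAt_oscCos L r)).add
      (hc.mul (hasDerivAt_oscSin L r))).congr_deriv ?_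
    simp only [Function.comp_apply]
    ring
  have := is_const_of_deriv_eq_zero (fun r => (h r).differentiableAt) (fun r => (h r).deriv) 0 b
  simpa using this

/-! ### Families of symbols with uniform temperate growth -/

/-- Smooth functions whose derivatives are polynomially bounded, uniformly over the family. -/
def UniformTemperateGrowth {α : Type*} (g : α → Space → ℂ) : Prop :=
  (∀ a, (g a).HasTemperateGrowth) ∧ ∀ n : ℕ, ∃ (k : ℕ) (C : ℝ), 0 ≤ C ∧ ∀ N ≤ n, ∀ a x,
    ‖iteratedFDeriv ℝ N (g a) x‖ ≤ C * (1 + ‖x‖) ^ k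

/-- Leibniz's rule. The polynomial growth of the symbol is absorbed by raising the weight of the
seminorm from `k` to `l + k`; all constants come from the common bound and do not depend on `a`. -/
lemma UniformTemperateGrowth.seminorm_smulLeft_le {α : Type*} {g : α → Space → ℂ}
    (hg : UniformTemperateGrowth g) (k n : ℕ) : ∃ (s : Finset (ℕ × ℕ)) (C : ℝ), 0 ≤ C ∧
      ∀ (a : α) (f : 𝓢(Space, ℂ)), SchwartzMap.seminorm ℂ k n (SchwartzMap.smulLeftCLM ℂ (g a) f) ≤
        C * s.sup (schwartzSeminormFamily ℂ Space ℂ) f := by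
  obtain ⟨l, C, hC, hgrowth⟩ := hg.2 n
  refine ⟨Finset.Iic (l + k, n), (∑ i ∈ Finset.range (n + 1), (n.choose i : ℝ)) * C * 2 ^ (l + k),
    by positivity, fun a f => ?_⟩
  refine SchwartzMap.seminorm_le_bound ℂ k n _ (by positivity) fun x => ?_
  have hfun : (SchwartzMap.smulLeftCLM ℂ (g a) f : Space → ℂ) = fun y => g a y * f y := by
    ext y; simp [SchwartzMap.smulLeftCLM_apply_apply (hg.1 a)]
  have h1 := norm_iteratedFDeriv_mul_le (hg.1 a).1 (f.smooth ⊤) x (n := n) (mod_cast le_top)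
  rw [hfun]
  refine (mul_le_mul_of_nonneg_left h1 (by positivity)).trans ?_
  rw [Finset.mul_sum, Finset.sum_mul, Finset.sum_mul, Finset.sum_mul]
  refine Finset.sum_le_sum fun i hi => ?_
  have hi' : i ≤ n := Finset.mem_range_succ_iff.1 hi
  have h2 := SchwartzMap.one_add_le_sup_seminorm_apply (𝕜 := ℂ) (m := (l + k, n)) (k := l + k)
    (n := n - i) le_rfl (Nat.sub_le n i) f x
  have h3 := hgrowth i hi' a x
  have h4 : ‖x‖ ^ k ≤ (1 + ‖x‖) ^ k := by gcongr; simp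
  calc ‖x‖ ^ k * ((n.choose i : ℝ) * ‖iteratedFDeriv ℝ i (g a) x‖ * ‖iteratedFDeriv ℝ (n - i) f x‖)
      ≤ (1 + ‖x‖) ^ k * ((n.choose i : ℝ) * (C * (1 + ‖x‖) ^ l) *
          ‖iteratedFDeriv ℝ (n - i) f x‖) := by gcongr
    _ = (n.choose i : ℝ) * C * ((1 + ‖x‖) ^ (l + k) * ‖iteratedFDeriv ℝ (n - i) f x‖) := by
        rw [pow_add]; ring
    _ ≤ (n.choose i : ℝ) * C * (2 ^ (l + k) *
          (Finset.Iic (l + k, n)).sup (fun m => SchwartzMap.seminorm ℂ m.1 m.2) f) := by gcongr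
    _ = _ := by rw [mul_assoc _ (2 ^ (l + k) : ℝ)]; rfl

/-- Equicontinuity at zero: the symbol may vary together with the test function. This is what makes
the propagators jointly continuous in time and test function. -/
lemma UniformTemperateGrowth.tendsto_fourierMultiplier {α : Type*} {g : α → Space → ℂ}
    (hg : UniformTemperateGrowth g) {l : Filter α} {ψ : α → 𝓢(Space, ℂ)}
    (hψ : Tendsto ψ l (𝓝 0)) :
    Tendsto (fun a => SchwartzMap.fourierMultiplierCLM ℂ (g a) (ψ a)) l (𝓝 0) := by
  have hF : Tendsto (fun a => 𝓕 (ψ a)) l (𝓝 0) := by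
    have h := ((fourierCLM ℂ 𝓢(Space, ℂ)).continuous.tendsto 0).comp hψ
    rwa [map_zero] at h
  have hm : Tendsto (fun a => SchwartzMap.smulLeftCLM ℂ (g a) (𝓕 (ψ a))) l (𝓝 0) := by
    rw [(schwartz_withSeminorms ℂ Space ℂ).tendsto_nhds]
    rintro ⟨k, n⟩ ε hε
    obtain ⟨s, C, hC, h⟩ := hg.seminorm_smulLeft_le k n
    have := ((schwartz_withSeminorms ℂ Space ℂ).tendsto_nhds' _ _).1 hF s (ε / (C + 1))
      (by positivity)
    filter_upwards [this] with a ha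
    rw [sub_zero] at ha ⊢
    calc _ ≤ C * s.sup (schwartzSeminormFamily ℂ Space ℂ) (𝓕 (ψ a)) := h a _
      _ ≤ C * (ε / (C + 1)) := by gcongr
      _ < ε := by rw [mul_div_assoc', div_lt_iff₀ (by positivity)]; nlinarith
  have h := ((fourierInvCLM ℂ 𝓢(Space, ℂ)).continuous.tendsto 0).comp hm
  rwa [map_zero] at h

/-! ### Fourier multipliers with real symbols -/

/-- The Fourier multiplier with a real symbol. -/
def multiplier (a : Space → ℝ) : 𝓢(Space, ℂ) →L[ℂ] 𝓢(Space, ℂ) :=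
  SchwartzMap.fourierMultiplierCLM ℂ (fun k => ((a k : ℝ) : ℂ))

variable {a b : Space → ℝ}

lemma hasTemperateGrowth_ofReal_comp (ha : a.HasTemperateGrowth) :
    (fun k => ((a k : ℝ) : ℂ)).HasTemperateGrowth :=
  Complex.ofRealCLM.hasTemperateGrowth.comp ha

lemma hasTemperateGrowth_mul (ha : a.HasTemperateGrowth) (hb : b.HasTemperateGrowth) :
    (fun k => a k * b k).HasTemperateGrowth := ha.mul hb

lemma multiplier_mul (ha : a.HasTemperateGrowth) (hb : b.HasTemperateGrowth) (f : 𝓢(Space, ℂ)) :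
    multiplier (fun k => a k * b k) f = multiplier a (multiplier b f) := by
  rw [multiplier, multiplier, multiplier,
    SchwartzMap.fourierMultiplierCLM_fourierMultiplierCLM_apply
      (hasTemperateGrowth_ofReal_comp ha) (hasTemperateGrowth_ofReal_comp hb)]
  congr 2; ext k; simp

lemma multiplier_add (ha : a.HasTemperateGrowth) (hb : b.HasTemperateGrowth) (f : 𝓢(Space, ℂ)) :
    multiplier (fun k => a k + b k) f = multiplier a f + multiplier b f := by
  simp only [multiplier, SchwartzMap.fourierMultiplierCLM_apply]
  rw [← FourierTransform.fourierInv_add]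
  congr 1
  have := SchwartzMap.smulLeftCLM_add (F := ℂ) (hasTemperateGrowth_ofReal_comp ha)
    (hasTemperateGrowth_ofReal_comp hb)
  rw [← add_apply, ← this]
  congr 2; ext k; simp

lemma multiplier_const (c : ℝ) (f : 𝓢(Space, ℂ)) :
    multiplier (fun _ => c) f = (c : ℂ) • f := by
  simp [multiplier]

lemma multiplier_const_mul (c : ℝ) (ha : a.HasTemperateGrowth) (f : 𝓢(Space, ℂ)) :
    multiplier (fun k => c * a k) f = (c : ℂ) • multiplier a f := by
  rw [multiplier_mul (.const c) ha, multiplier_const]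

/-- The Fourier transform is symmetric for the bilinear pairing and differs from its inverse by a
reflection, which an even symbol does not see. -/
lemma integral_multiplier_mul (ha : a.HasTemperateGrowth) (heven : ∀ k, a (-k) = a k)
    (f h : 𝓢(Space, ℂ)) : ∫ x, multiplier a f x * h x = ∫ x, f x * multiplier a h x := by
  have ha' := hasTemperateGrowth_ofReal_comp ha
  have hinv : ∀ (g : 𝓢(Space, ℂ)) k, 𝓕⁻ g k = 𝓕 g (-k) := fun g k => by
    rw [SchwartzMap.fourierInv_coe, SchwartzMap.fourier_coe, Real.fourierInv_eq_fourier_neg]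
  simp only [multiplier, SchwartzMap.fourierMultiplierCLM_apply]
  rw [SchwartzMap.integral_fourierInv_mul_eq]
  have h2 := SchwartzMap.integral_fourierInv_mul_eq f
    (SchwartzMap.smulLeftCLM ℂ (fun k => ((a k : ℝ) : ℂ)) (𝓕 h))
  rw [← h2, ← integral_neg_eq_self]
  refine integral_congr_ae (.of_forall fun k => ?_)
  simp only [SchwartzMap.smulLeftCLM_apply_apply ha', hinv, neg_neg, heven, smul_eq_mul]
  ring

/-! ### The Klein-Gordon propagators with arbitrary real squared mass -/

/-- The squared frequency `(2π|k|)² + μ`. -/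
def dispersion (μ : ℝ) (k : Space) : ℝ := (2 * Real.pi * ‖k‖) ^ 2 + μ

lemma dispersion_neg (μ : ℝ) (k : Space) : dispersion μ (-k) = dispersion μ k := by
  simp [dispersion]

lemma hasTemperateGrowth_dispersion (μ : ℝ) : (dispersion μ).HasTemperateGrowth := by
  have : dispersion μ = fun k => (2 * Real.pi) ^ 2 * ‖k‖ ^ 2 + μ := by
    ext k; simp [dispersion]; ring
  rw [this]
  have h := Function.hasTemperateGrowth_norm_sq Space
  fun_prop

/-- For `|τ| ≤ T` the argument `τ² * dispersion μ k` stays above `-T² |μ|`, where all derivatives of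
`stumpff n` are bounded. The derivatives of the dispersion grow polynomially, and the bound for
derivatives of a composition combines the two. -/
lemma uniformTemperateGrowth_stumpff (μ T : ℝ) (n : ℕ) {α : Type*} {τ : α → ℝ}
    (hτ : ∀ a, |τ a| ≤ T) : UniformTemperateGrowth
      (fun a k => ((stumpff n (τ a ^ 2 * dispersion μ k) : ℝ) : ℂ)) := by
  suffices hmain : ∀ N : ℕ, ∃ (k : ℕ) (C : ℝ), 0 ≤ C ∧ ∀ m ≤ N, ∀ a x,
      ‖iteratedFDeriv ℝ m (fun k => ((stumpff n (τ a ^ 2 * dispersion μ k) : ℝ) : ℂ)) x‖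
        ≤ C * (1 + ‖x‖) ^ k by
    refine ⟨fun a => ⟨?_, fun N => ?_⟩, hmain⟩
    · have hst : ContDiff ℝ (⊤ : ℕ∞) (stumpff n) := contDiff_infty.2 fun m => contDiff_stumpff m n
      exact Complex.ofRealCLM.contDiff.comp (hst.comp
        (contDiff_const.mul (hasTemperateGrowth_dispersion μ).1))
    · obtain ⟨k, C, -, h⟩ := hmain N
      exact ⟨k, C, fun x => h N le_rfl a x⟩
  intro N
  obtain ⟨l, A, hA, hdisp⟩ := (hasTemperateGrowth_dispersion μ).norm_iteratedFDeriv_le_uniform N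
  obtain ⟨B, hB⟩ := iteratedFDeriv_stumpff_bounded (T ^ 2 * |μ|) N n
  refine ⟨l * N, N.factorial * |B| * (1 + T ^ 2 * A) ^ N, by positivity, fun m hm a x => ?_⟩
  have hT : τ a ^ 2 ≤ T ^ 2 := by
    rw [← sq_abs (τ a)]
    exact pow_le_pow_left₀ (abs_nonneg _) (hτ a) 2
  have hrange : ∀ y, -(T ^ 2 * |μ|) ≤ τ a ^ 2 * dispersion μ y := by
    intro y
    have h1 : -|μ| ≤ dispersion μ y :=
      (neg_abs_le μ).trans (by rw [dispersion]; nlinarith [sq_nonneg (2 * Real.pi * ‖y‖)])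
    nlinarith [abs_nonneg μ, sq_nonneg (τ a)]
  have hst : ContDiff ℝ N (stumpff n) := contDiff_stumpff N n
  have hsm : ContDiff ℝ N (fun y => τ a ^ 2 * dispersion μ y) :=
    contDiff_const.mul ((hasTemperateGrowth_dispersion μ).1.of_le (mod_cast le_top))
  -- The composition bound asks for `D ^ i` against the `i`-th derivative; the summand 1 ensures `1
  -- ≤ D`, so that `D ≤ D ^ i`.
  set D : ℝ := (1 + T ^ 2 * A) * (1 + ‖x‖) ^ l with hD
  have hx1 : 1 ≤ (1 + ‖x‖) ^ l := one_le_pow₀ (by simp)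
  have hD1 : 1 ≤ D := one_le_mul_of_one_le_of_one_le (by simp; positivity) hx1
  have hcomp := norm_iteratedFDeriv_comp_le (n := m) hst hsm (mod_cast hm) x (C := |B|) (D := D)
    (fun i hi => (hB i (hi.trans hm) _ (hrange x)).trans (le_abs_self B)) (fun i hi1 hi => by
      refine le_trans ?_ (le_self_pow₀ hD1 (by omega))
      have := iteratedFDeriv_const_smul_apply' (𝕜 := ℝ) (a := τ a ^ 2) (i := i) (x := x)
        (f := dispersion μ)
        ((hasTemperateGrowth_dispersion μ).1.contDiffAt.of_le (mod_cast le_top))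
      simp only [smul_eq_mul] at this
      rw [this, norm_smul, Real.norm_of_nonneg (sq_nonneg _)]
      calc τ a ^ 2 * ‖iteratedFDeriv ℝ i (dispersion μ) x‖
          ≤ T ^ 2 * (A * (1 + ‖x‖) ^ l) := by gcongr; exact hdisp i (hi.trans hm) x
        _ ≤ D := by rw [hD]; nlinarith)
  have hiso : ‖iteratedFDeriv ℝ m (fun k => ((stumpff n (τ a ^ 2 * dispersion μ k) : ℝ) : ℂ)) x‖
      = ‖iteratedFDeriv ℝ m (stumpff n ∘ fun k => τ a ^ 2 * dispersion μ k) x‖ :=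
    Complex.ofRealLI.norm_iteratedFDeriv_comp_left (n := N) (hst.comp hsm).contDiffAt (mod_cast hm)
  rw [hiso]
  refine hcomp.trans ?_
  calc (m.factorial : ℝ) * |B| * D ^ m ≤ N.factorial * |B| * D ^ N := by
        gcongr
    _ = _ := by rw [hD, mul_pow, ← pow_mul]; ring

/-- The Fourier multiplier with symbol `stumpff n (τ² ((2π|k|)² + μ))`. -/
def stumpffOp (μ : ℝ) (n : ℕ) (τ : ℝ) : 𝓢(Space, ℂ) →L[ℂ] 𝓢(Space, ℂ) :=
  multiplier (fun k => stumpff n (τ ^ 2 * dispersion μ k))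

lemma hasTemperateGrowth_stumpff (μ τ : ℝ) (n : ℕ) :
    (fun k => stumpff n (τ ^ 2 * dispersion μ k)).HasTemperateGrowth := by
  have h := (uniformTemperateGrowth_stumpff μ |τ| n (τ := fun _ : Unit => τ) fun _ => le_rfl).1 ()
  exact (Complex.reCLM.hasTemperateGrowth.comp h :)

lemma tendsto_stumpffOp_zero (μ T : ℝ) (n : ℕ) {α : Type*} {l : Filter α} {τ : α → ℝ}
    (hτ : ∀ᶠ a in l, |τ a| ≤ T) {ψ : α → 𝓢(Space, ℂ)} (hψ : Tendsto ψ l (𝓝 0)) :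
    Tendsto (fun a => stumpffOp μ n (τ a) (ψ a)) l (𝓝 0) := by
  by_cases hT : 0 ≤ T
  -- Uniform growth needs the time bound at every index, so times beyond `T` are replaced by `0`;
  -- the filter does not notice.
  · have h := (uniformTemperateGrowth_stumpff μ T n
      (τ := fun a => if |τ a| ≤ T then τ a else 0) (fun a => by
        split_ifs with h <;> simp [h, hT])).tendsto_fourierMultiplier hψ
    refine h.congr' ?_
    filter_upwards [hτ] with a ha
    simp only [ha, if_true]
    rfl
  · have : l = ⊥ := by
      rw [← eventually_false_iff_eq_bot]
      filter_upwards [hτ] with a ha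
      exact hT ((abs_nonneg _).trans ha)
    rw [this]; exact tendsto_bot

/-- The spatial Klein-Gordon operator `f ↦ (Δ - μ) f` with squared mass `μ`. -/
def kgOp (μ : ℝ) : 𝓢(Space, ℂ) →L[ℂ] 𝓢(Space, ℂ) := multiplier (fun k => -dispersion μ k)

/-- The Klein-Gordon propagator `cos (τ √(μ - Δ))`. -/
def propCos (μ τ : ℝ) : 𝓢(Space, ℂ) →L[ℂ] 𝓢(Space, ℂ) :=
  multiplier (fun k => oscCos (dispersion μ k) τ)

/-- The Klein-Gordon propagator `sin (τ √(μ - Δ)) / √(μ - Δ)`. -/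
def propSin (μ τ : ℝ) : 𝓢(Space, ℂ) →L[ℂ] 𝓢(Space, ℂ) :=
  multiplier (fun k => oscSin (dispersion μ k) τ)

lemma hasTemperateGrowth_neg_dispersion (μ : ℝ) :
    (fun k => -dispersion μ k).HasTemperateGrowth := (hasTemperateGrowth_dispersion μ).neg

lemma hasTemperateGrowth_oscCos (μ τ : ℝ) :
    (fun k => oscCos (dispersion μ k) τ).HasTemperateGrowth := hasTemperateGrowth_stumpff μ τ 0

lemma hasTemperateGrowth_oscSin (μ τ : ℝ) :
    (fun k => oscSin (dispersion μ k) τ).HasTemperateGrowth :=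
  (Function.HasTemperateGrowth.const τ).mul (hasTemperateGrowth_stumpff μ τ 1)

lemma kgOp_apply (μ : ℝ) (f : 𝓢(Space, ℂ)) : kgOp μ f = Δ f - (μ : ℂ) • f := by
  have h0 : (fun k : Space => ‖k‖ ^ 2).HasTemperateGrowth := Function.hasTemperateGrowth_norm_sq Space
  have h1 : kgOp μ f = multiplier (fun k => -(2 * Real.pi) ^ 2 * ‖k‖ ^ 2 + -μ) f := by
    rw [kgOp]; congr 2; ext k; simp [dispersion]; ring
  rw [h1, multiplier_add (hasTemperateGrowth_mul (.const _) h0) (.const _),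
    multiplier_const_mul _ h0, multiplier_const, SchwartzMap.laplacian_eq_fourierMultiplierCLM,
    multiplier, show SchwartzMap.fourierMultiplierCLM ℂ (fun k : Space => ((‖k‖ ^ 2 : ℝ) : ℂ)) f
      = SchwartzMap.fourierMultiplierCLM ℂ (fun k : Space => ‖k‖ ^ 2) f from
      SchwartzMap.fourierMultiplierCLM_ofReal ℂ h0 f]
  rw [sub_eq_add_neg, Complex.ofReal_neg μ, neg_smul (μ : ℂ)]
  congr 1

lemma kgSpatial_eq (m : ℝ) (f : 𝓢(Space, ℂ)) : kgSpatial m f = kgOp (m ^ 2) f := by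
  rw [kgOp_apply, kgSpatial]; push_cast; rfl

lemma freq_sq (m : ℝ) (k : Space) : freq m k ^ 2 = dispersion (m ^ 2) k := by
  rw [freq, Real.sq_sqrt (by positivity), dispersion]

lemma kgCos_eq (m τ : ℝ) : kgCos m τ = propCos (m ^ 2) τ := by
  rw [kgCos, propCos, multiplier]
  congr 2; ext k
  rw [oscCos, ← freq_sq, ← mul_pow, stumpff_zero_sq]

lemma kgSin_eq (m τ : ℝ) : kgSin m τ = propSin (m ^ 2) τ := by
  rw [kgSin, propSin, multiplier]
  congr 2; ext k
  rw [oscSin, ← freq_sq, ← mul_pow, stumpff_one_sq]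

lemma propCos_eq_stumpffOp (μ τ : ℝ) : propCos μ τ = stumpffOp μ 0 τ := rfl

lemma propSin_eq_stumpffOp (μ τ : ℝ) (f : 𝓢(Space, ℂ)) :
    propSin μ τ f = (τ : ℂ) • stumpffOp μ 1 τ f :=
  multiplier_const_mul τ (hasTemperateGrowth_stumpff μ τ 1) f

/-- Taylor's formula at `τ = 0` with remainder: the operator in the remainder stays equicontinuous
for bounded `τ`, while its argument carries the factor τ². The sign is plus because `kgOp μ` has
symbol `-dispersion μ`. -/
lemma stumpffOp_recurrence (μ τ : ℝ) (n : ℕ) (f : 𝓢(Space, ℂ)) :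
    stumpffOp μ n τ f = ((1 / n.factorial : ℝ) : ℂ) • f
      + stumpffOp μ (n + 2) τ (((τ ^ 2 : ℝ) : ℂ) • kgOp μ f) := by
  have h1 := hasTemperateGrowth_stumpff μ τ (n + 2)
  have h2 := hasTemperateGrowth_neg_dispersion μ
  have h3 := hasTemperateGrowth_mul (.const (τ ^ 2)) h2
  rw [← multiplier_const, kgOp, ← multiplier_const_mul _ h2, stumpffOp, stumpffOp,
    ← multiplier_mul h1 h3, ← multiplier_add (.const _) (hasTemperateGrowth_mul h1 h3)]
  congr 2; ext k
  rw [stumpff_recurrence]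
  ring

/-! ### Trigonometric identities and symmetry of the propagators -/

section algebra
variable (μ s t : ℝ) (f h : 𝓢(Space, ℂ))

@[simp] lemma propCos_zero : propCos μ 0 f = f := by
  simp [propCos, multiplier_const]

@[simp] lemma propSin_zero : propSin μ 0 f = 0 := by
  simp [propSin, multiplier_const]

lemma propCos_neg : propCos μ (-t) = propCos μ t := by simp [propCos]

lemma propSin_neg : propSin μ (-t) f = -propSin μ t f := by
  have := multiplier_const_mul (-1) (hasTemperateGrowth_oscSin μ t) f
  simp only [neg_mul, one_mul, Complex.ofReal_neg, Complex.ofReal_one, neg_smul, one_smul] at this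
  simpa [propSin] using this

lemma propCos_add : propCos μ (s + t) f
    = propCos μ s (propCos μ t f) + propSin μ s (propSin μ t (kgOp μ f)) := by
  have hc := hasTemperateGrowth_oscCos μ
  have hs := hasTemperateGrowth_oscSin μ
  have hk := hasTemperateGrowth_neg_dispersion μ
  simp only [propCos, propSin, kgOp]
  rw [← multiplier_mul (hc s) (hc t), ← multiplier_mul (hs t) hk,
    ← multiplier_mul (hs s) (hasTemperateGrowth_mul (hs t) hk), ← multiplier_add (hasTemperateGrowth_mul (hc s) (hc t))
      (hasTemperateGrowth_mul (hs s) (hasTemperateGrowth_mul (hs t) hk))]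
  congr 2; ext k
  simp only [oscCos_add]; ring

lemma propSin_add : propSin μ (s + t) f
    = propSin μ s (propCos μ t f) + propCos μ s (propSin μ t f) := by
  have hc := hasTemperateGrowth_oscCos μ
  have hs := hasTemperateGrowth_oscSin μ
  simp only [propCos, propSin]
  rw [← multiplier_mul (hs s) (hc t), ← multiplier_mul (hc s) (hs t),
    ← multiplier_add (hasTemperateGrowth_mul (hs s) (hc t)) (hasTemperateGrowth_mul (hc s) (hs t))]
  congr 2; ext k
  simp only [oscSin_add]

lemma propSin_sub : propSin μ (s - t) f
    = propCos μ t (propSin μ s f) - propSin μ t (propCos μ s f) := by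
  rw [sub_eq_add_neg, add_comm, propSin_add, propSin_neg, propCos_neg]; abel

lemma kgOp_propSin : kgOp μ (propSin μ t f) = propSin μ t (kgOp μ f) := by
  have hs := hasTemperateGrowth_oscSin μ t
  have hk := hasTemperateGrowth_neg_dispersion μ
  simp only [propSin, kgOp]
  rw [← multiplier_mul hk hs, ← multiplier_mul hs hk]
  congr 2; ext k; ring

lemma integral_propCos_mul : ∫ x, propCos μ t f x * h x = ∫ x, f x * propCos μ t h x :=
  integral_multiplier_mul (hasTemperateGrowth_oscCos μ t) (fun k => by rw [dispersion_neg]) f h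

lemma integral_propSin_mul : ∫ x, propSin μ t f x * h x = ∫ x, f x * propSin μ t h x :=
  integral_multiplier_mul (hasTemperateGrowth_oscSin μ t) (fun k => by rw [dispersion_neg]) f h

lemma integral_kgOp_mul : ∫ x, kgOp μ f x * h x = ∫ x, f x * kgOp μ h x :=
  integral_multiplier_mul (hasTemperateGrowth_neg_dispersion μ) (fun k => by rw [dispersion_neg]) f h

end algebra

/-! ### Joint continuity and differentiability in time, in the Schwartz topology -/

lemma tendsto_stumpffOp_at_zero (μ : ℝ) (n : ℕ) (f : 𝓢(Space, ℂ)) :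
    Tendsto (fun q : ℝ × 𝓢(Space, ℂ) => stumpffOp μ n q.1 q.2) (𝓝 (0, f))
      (𝓝 (((1 / n.factorial : ℝ) : ℂ) • f)) := by
  have h1 : Tendsto (fun q : ℝ × 𝓢(Space, ℂ) => ((q.1 ^ 2 : ℝ) : ℂ) • kgOp μ q.2)
      (𝓝 (0, f)) (𝓝 0) := by
    have : Continuous fun q : ℝ × 𝓢(Space, ℂ) => ((q.1 ^ 2 : ℝ) : ℂ) • kgOp μ q.2 := by fun_prop
    simpa using this.tendsto (0, f)
  have h2 : ∀ᶠ q : ℝ × 𝓢(Space, ℂ) in 𝓝 (0, f), |q.1| ≤ 1 := by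
    have : Continuous fun q : ℝ × 𝓢(Space, ℂ) => |q.1| := by fun_prop
    exact (this.tendsto (0, f)).eventually_le_const (by simp)
  have h3 := tendsto_stumpffOp_zero μ 1 (n + 2) h2 h1
  have h4 : Tendsto (fun q : ℝ × 𝓢(Space, ℂ) => ((1 / n.factorial : ℝ) : ℂ) • q.2) (𝓝 (0, f))
      (𝓝 (((1 / n.factorial : ℝ) : ℂ) • f)) :=
    Continuous.tendsto (by fun_prop) (0, f)
  have h := h4.add h3
  rw [add_zero] at h
  exact h.congr fun q => (stumpffOp_recurrence μ q.1 n q.2).symm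

lemma tendsto_propCos_at_zero (μ : ℝ) (f : 𝓢(Space, ℂ)) :
    Tendsto (fun q : ℝ × 𝓢(Space, ℂ) => propCos μ q.1 q.2) (𝓝 (0, f)) (𝓝 f) := by
  simpa [propCos_eq_stumpffOp] using tendsto_stumpffOp_at_zero μ 0 f

lemma tendsto_propSin_at_zero (μ : ℝ) (f : 𝓢(Space, ℂ)) :
    Tendsto (fun q : ℝ × 𝓢(Space, ℂ) => propSin μ q.1 q.2) (𝓝 (0, f)) (𝓝 0) := by
  have h1 := tendsto_stumpffOp_at_zero μ 1 f
  have h2 : Tendsto (fun q : ℝ × 𝓢(Space, ℂ) => (q.1 : ℂ)) (𝓝 (0, f)) (𝓝 ((0 : ℝ) : ℂ)) :=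
    Continuous.tendsto (by fun_prop) (0, f)
  simpa [propSin_eq_stumpffOp] using h2.smul h1

/-- The addition formula at `t + (q.1 - t)` reduces continuity at time `t` to continuity at time
`0`. -/
lemma continuous_propCos (μ : ℝ) :
    Continuous fun q : ℝ × 𝓢(Space, ℂ) => propCos μ q.1 q.2 := by
  rw [continuous_iff_continuousAt]
  rintro ⟨t, f⟩
  have hsub : Tendsto (fun q : ℝ × 𝓢(Space, ℂ) => (q.1 - t, q.2)) (𝓝 (t, f)) (𝓝 (0, f)) := by
    simpa using Continuous.tendsto (f := fun q : ℝ × 𝓢(Space, ℂ) => (q.1 - t, q.2))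
      (by fun_prop) (t, f)
  have hsub' : Tendsto (fun q : ℝ × 𝓢(Space, ℂ) => (q.1 - t, kgOp μ q.2)) (𝓝 (t, f))
      (𝓝 (0, kgOp μ f)) := by
    simpa using Continuous.tendsto (f := fun q : ℝ × 𝓢(Space, ℂ) => (q.1 - t, kgOp μ q.2))
      (by fun_prop) (t, f)
  have h1 := ((propCos μ t).continuous.tendsto _).comp ((tendsto_propCos_at_zero μ f).comp hsub)
  have h2 := ((propSin μ t).continuous.tendsto _).comp
    ((tendsto_propSin_at_zero μ (kgOp μ f)).comp hsub')
  have h := h1.add h2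
  rw [map_zero, add_zero] at h
  refine h.congr fun q => ?_
  simp only [Function.comp_apply]
  rw [← propCos_add]; simp

lemma continuous_propSin (μ : ℝ) :
    Continuous fun q : ℝ × 𝓢(Space, ℂ) => propSin μ q.1 q.2 := by
  rw [continuous_iff_continuousAt]
  rintro ⟨t, f⟩
  have hsub : Tendsto (fun q : ℝ × 𝓢(Space, ℂ) => (q.1 - t, q.2)) (𝓝 (t, f)) (𝓝 (0, f)) := by
    simpa using Continuous.tendsto (f := fun q : ℝ × 𝓢(Space, ℂ) => (q.1 - t, q.2))
      (by fun_prop) (t, f)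
  have h1 := ((propSin μ t).continuous.tendsto _).comp ((tendsto_propCos_at_zero μ f).comp hsub)
  have h2 := ((propCos μ t).continuous.tendsto _).comp ((tendsto_propSin_at_zero μ f).comp hsub)
  have h := h1.add h2
  rw [map_zero, add_zero] at h
  refine h.congr fun q => ?_
  simp only [Function.comp_apply]
  rw [← propSin_add]; simp

/-- Differentiability of a curve of test functions in the Schwartz topology. -/
def HasCurveDerivAt (ψ : ℝ → 𝓢(Space, ℂ)) (ψ' : 𝓢(Space, ℂ)) (t : ℝ) : Prop :=
  Tendsto (fun s => ((s - t : ℝ) : ℂ)⁻¹ • (ψ s - ψ t)) (𝓝[≠] t) (𝓝 ψ')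

lemma hasCurveDerivAt_propSin_zero (μ : ℝ) (f : 𝓢(Space, ℂ)) :
    HasCurveDerivAt (fun τ => propSin μ τ f) f 0 := by
  have h := (tendsto_stumpffOp_at_zero μ 1 f).comp
    (Continuous.tendsto (f := fun τ : ℝ => (τ, f)) (by fun_prop) 0)
  simp only [Nat.factorial, Nat.cast_one, div_one, Complex.ofReal_one, one_smul, mul_one] at h
  refine (h.mono_left nhdsWithin_le_nhds).congr' ?_
  filter_upwards [self_mem_nhdsWithin] with τ hτ
  have : (τ : ℂ) ≠ 0 := by exact_mod_cast hτ
  rw [propSin_zero, propSin_eq_stumpffOp, sub_zero, sub_zero, smul_smul, inv_mul_cancel₀ this,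
    one_smul]
  rfl

lemma hasCurveDerivAt_propCos_zero (μ : ℝ) (f : 𝓢(Space, ℂ)) :
    HasCurveDerivAt (fun τ => propCos μ τ f) 0 0 := by
  have h1 : Tendsto (fun τ : ℝ => (τ : ℂ) • kgOp μ f) (𝓝 0) (𝓝 0) := by
    simpa using Continuous.tendsto (f := fun τ : ℝ => (τ : ℂ) • kgOp μ f) (by fun_prop) 0
  have h2 : ∀ᶠ τ : ℝ in 𝓝 0, |τ| ≤ 1 :=
    (continuous_abs.tendsto (0 : ℝ)).eventually_le_const (by simp)
  have h := tendsto_stumpffOp_zero μ 1 2 h2 h1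
  refine (h.mono_left nhdsWithin_le_nhds).congr' ?_
  filter_upwards [self_mem_nhdsWithin] with τ hτ
  have : (τ : ℂ) ≠ 0 := by exact_mod_cast hτ
  simp only [propCos_eq_stumpffOp, stumpffOp_recurrence μ _ 0]
  simp [smul_smul, sq, this]

lemma HasCurveDerivAt.congr_shift {ψ : ℝ → 𝓢(Space, ℂ)} {ψ' : 𝓢(Space, ℂ)} {t : ℝ}
    (h : HasCurveDerivAt (fun s => ψ (t + s)) ψ' 0) : HasCurveDerivAt ψ ψ' t := by
  have hs : Tendsto (fun s : ℝ => s - t) (𝓝[≠] t) (𝓝[≠] 0) := by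
    refine tendsto_nhdsWithin_of_tendsto_nhds_of_eventually_within _ ?_ ?_
    · refine Tendsto.mono_left ?_ nhdsWithin_le_nhds
      simpa using Continuous.tendsto (f := fun s : ℝ => s - t) (by fun_prop) t
    · filter_upwards [self_mem_nhdsWithin] with s hs
      exact sub_ne_zero.2 hs
  refine (h.comp hs).congr fun s => ?_
  simp

lemma HasCurveDerivAt.add {ψ χ : ℝ → 𝓢(Space, ℂ)} {ψ' χ' : 𝓢(Space, ℂ)} {t : ℝ}
    (h : HasCurveDerivAt ψ ψ' t) (h' : HasCurveDerivAt χ χ' t) :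
    HasCurveDerivAt (fun s => ψ s + χ s) (ψ' + χ') t := by
  refine (Tendsto.add h h').congr fun s => ?_
  rw [← smul_add, add_sub_add_comm]

lemma HasCurveDerivAt.const_smul {ψ : ℝ → 𝓢(Space, ℂ)} {ψ' : 𝓢(Space, ℂ)} {t : ℝ}
    (h : HasCurveDerivAt ψ ψ' t) (c : ℂ) : HasCurveDerivAt (fun s => c • ψ s) (c • ψ') t := by
  refine (Tendsto.const_smul h c).congr fun s => ?_
  rw [← smul_sub, smul_comm]

lemma HasCurveDerivAt.clm_apply {ψ : ℝ → 𝓢(Space, ℂ)} {ψ' : 𝓢(Space, ℂ)} {t : ℝ}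
    (h : HasCurveDerivAt ψ ψ' t) (A : 𝓢(Space, ℂ) →L[ℂ] 𝓢(Space, ℂ)) :
    HasCurveDerivAt (fun s => A (ψ s)) (A ψ') t := by
  refine ((A.continuous.tendsto _).comp h).congr fun s => ?_
  simp

lemma hasCurveDerivAt_propCos (μ t : ℝ) (f : 𝓢(Space, ℂ)) :
    HasCurveDerivAt (fun τ => propCos μ τ f) (propSin μ t (kgOp μ f)) t := by
  apply HasCurveDerivAt.congr_shift
  simp only [propCos_add]
  simpa using ((hasCurveDerivAt_propCos_zero μ f).clm_apply (propCos μ t)).add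
    ((hasCurveDerivAt_propSin_zero μ (kgOp μ f)).clm_apply (propSin μ t))

lemma hasCurveDerivAt_propSin (μ t : ℝ) (f : 𝓢(Space, ℂ)) :
    HasCurveDerivAt (fun τ => propSin μ τ f) (propCos μ t f) t := by
  apply HasCurveDerivAt.congr_shift
  simp only [propSin_add]
  simpa using ((hasCurveDerivAt_propCos_zero μ f).clm_apply (propSin μ t)).add
    ((hasCurveDerivAt_propSin_zero μ f).clm_apply (propCos μ t))

/-- Reversal of time `s ↦ b - s`. -/
lemma HasCurveDerivAt.comp_const_sub {ψ : ℝ → 𝓢(Space, ℂ)} {ψ' : 𝓢(Space, ℂ)} {b t : ℝ}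
    (h : HasCurveDerivAt ψ ψ' (b - t)) : HasCurveDerivAt (fun s => ψ (b - s)) (-ψ') t := by
  have hs : Tendsto (fun s : ℝ => b - s) (𝓝[≠] t) (𝓝[≠] (b - t)) := by
    refine tendsto_nhdsWithin_of_tendsto_nhds_of_eventually_within _ ?_ ?_
    · exact Tendsto.mono_left (Continuous.tendsto (f := fun s : ℝ => b - s) (by fun_prop) t)
        nhdsWithin_le_nhds
    · filter_upwards [self_mem_nhdsWithin] with s hs
      intro h'
      exact hs (by simpa using h')
  refine (h.comp hs).neg.congr fun s => ?_
  simp only [Function.comp_apply]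
  rw [← neg_smul, ← inv_neg, ← Complex.ofReal_neg]
  congr 4; ring

/-! ### Duhamel's formula for weak solutions of the Klein-Gordon equation -/

/-- `φ` with velocity `π` is a weak solution of `(□ + μ) φ = - J` at the times in `I`. -/
structure WeakKG (I : Set ℝ) (μ : ℝ) (φ π J : ℝ → 𝓢(Space, ℂ) →ₗ[ℂ] ℂ) : Prop where
  continuousOn_field : ContinuousOn (fun q : ℝ × 𝓢(Space, ℂ) => φ q.1 q.2) (I ×ˢ univ)
  continuousOn_momentum : ContinuousOn (fun q : ℝ × 𝓢(Space, ℂ) => π q.1 q.2) (I ×ˢ univ)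
  continuousOn_source : ContinuousOn (fun q : ℝ × 𝓢(Space, ℂ) => J q.1 q.2) (I ×ˢ univ)
  deriv_field : ∀ f, ∀ t ∈ I, HasDerivWithinAt (fun s => φ s f) (π t f) I t
  deriv_momentum : ∀ f, ∀ t ∈ I, HasDerivWithinAt (fun s => π s f) (φ t (kgOp μ f) - J t f) I t

lemma HasCurveDerivAt.continuousAt {ψ : ℝ → 𝓢(Space, ℂ)} {ψ' : 𝓢(Space, ℂ)} {t : ℝ}
    (h : HasCurveDerivAt ψ ψ' t) : ContinuousAt ψ t := by
  rw [continuousAt_iff_punctured_nhds]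
  have h1 : Tendsto (fun s : ℝ => ((s - t : ℝ) : ℂ)) (𝓝[≠] t) (𝓝 0) := by
    refine Tendsto.mono_left ?_ nhdsWithin_le_nhds
    simpa using Continuous.tendsto (f := fun s : ℝ => ((s - t : ℝ) : ℂ)) (by fun_prop) t
  have h2 := (Tendsto.smul h1 h).add (tendsto_const_nhds (x := ψ t))
  rw [zero_smul, zero_add] at h2
  refine h2.congr' ?_
  filter_upwards [self_mem_nhdsWithin] with s hs
  have : ((s - t : ℝ) : ℂ) ≠ 0 := by exact_mod_cast sub_ne_zero.2 hs
  rw [smul_smul, mul_inv_cancel₀ this, one_smul, sub_add_cancel]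

/-- Product rule: the difference quotient splits into that of `φ` at the fixed test function `ψ t`
and `φ s` applied to the quotient of `ψ`. Joint continuity of `φ` gives the limit of the second
part. -/
lemma hasDerivWithinAt_apply_curve {I : Set ℝ} {φ : ℝ → 𝓢(Space, ℂ) →ₗ[ℂ] ℂ}
    (hφ : ContinuousOn (fun q : ℝ × 𝓢(Space, ℂ) => φ q.1 q.2) (I ×ˢ univ))
    {ψ : ℝ → 𝓢(Space, ℂ)} {ψ' : 𝓢(Space, ℂ)} {t : ℝ} (ht : t ∈ I) {d : ℂ}
    (hd : HasDerivWithinAt (fun s => φ s (ψ t)) d I t) (hψ : HasCurveDerivAt ψ ψ' t) :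
    HasDerivWithinAt (fun s => φ s (ψ s)) (d + φ t ψ') I t := by
  rw [hasDerivWithinAt_iff_tendsto_slope] at hd ⊢
  have h1 : Tendsto (fun s => (s, ((s - t : ℝ) : ℂ)⁻¹ • (ψ s - ψ t))) (𝓝[I \ {t}] t)
      (𝓝[I ×ˢ univ] (t, ψ')) := by
    rw [nhdsWithin_prod_eq, nhdsWithin_univ]
    refine Tendsto.prodMk ?_ ?_
    · exact tendsto_id.mono_left (nhdsWithin_mono _ sdiff_subset)
    · exact Tendsto.mono_left hψ (nhdsWithin_mono _ fun s hs => hs.2)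
  have h2 := ((hφ (t, ψ') ⟨ht, mem_univ _⟩).tendsto.comp h1)
  refine (hd.add h2).congr fun s => ?_
  simp only [slope_def_module, Function.comp_apply, map_smul, map_sub]
  rw [Complex.real_smul, Complex.real_smul, smul_eq_mul, Complex.ofReal_inv]
  ring

/-- The curves `α`, `β` solve the homogeneous equation on test functions. When they run backwards
from `b`, the terms with `kgOp μ` and with `α` cancel in the derivative of `φ r (α (b - r)) + π r (β
(b - r))`, and only the source survives. -/
lemma WeakKG.duhamel {I : Set ℝ} (hI : I.OrdConnected) {μ : ℝ} {φ π J : ℝ → 𝓢(Space, ℂ) →ₗ[ℂ] ℂ}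
    (h : WeakKG I μ φ π J) {α β : ℝ → 𝓢(Space, ℂ)}
    (hα : ∀ τ, HasCurveDerivAt α (kgOp μ (β τ)) τ) (hβ : ∀ τ, HasCurveDerivAt β (α τ) τ)
    {a b : ℝ} (ha : a ∈ I) (hb : b ∈ I) :
    φ b (α 0) + π b (β 0)
      = φ a (α (b - a)) + π a (β (b - a)) - ∫ r in a..b, J r (β (b - r)) := by
  have hF : ∀ r ∈ I, HasDerivWithinAt (fun r => φ r (α (b - r)) + π r (β (b - r)))
      (-J r (β (b - r))) I r := by
    intro r hr
    have h1 := hasDerivWithinAt_apply_curve h.continuousOn_field hr (h.deriv_field _ r hr)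
      ((hα (b - r)).comp_const_sub)
    have h2 := hasDerivWithinAt_apply_curve h.continuousOn_momentum hr (h.deriv_momentum _ r hr)
      ((hβ (b - r)).comp_const_sub)
    refine (h1.add h2).congr_deriv ?_
    simp only [map_neg]
    ring
  have hsub : uIcc a b ⊆ I := hI.uIcc_subset ha hb
  have hβc : Continuous fun r => (r, β (b - r)) := by
    refine continuous_id.prodMk ?_
    exact (continuous_iff_continuousAt.2 fun τ => (hβ τ).continuousAt).comp (by fun_prop)
  have hint : IntervalIntegrable (fun r => -J r (β (b - r))) volume a b := by
    refine ContinuousOn.intervalIntegrable ?_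
    refine ContinuousOn.neg ?_
    exact h.continuousOn_source.comp hβc.continuousOn fun r hr => ⟨hsub hr, mem_univ _⟩
  have key := intervalIntegral.integral_eq_sub_of_hasDeriv_right
    (fun r hr => ((hF r (hsub hr)).mono hsub).continuousWithinAt)
    (fun r hr => ((hF r (hsub (Ioo_subset_Icc_self hr))).hasDerivAt
      (mem_of_superset (isOpen_Ioo.mem_nhds hr)
        (Ioo_subset_Icc_self.trans hsub))).hasDerivWithinAt) hint
  rw [intervalIntegral.integral_neg] at key
  simp only [sub_self] at key
  linear_combination -key

lemma WeakKG.field_eq {I : Set ℝ} (hI : I.OrdConnected) {μ : ℝ}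
    {φ π J : ℝ → 𝓢(Space, ℂ) →ₗ[ℂ] ℂ} (h : WeakKG I μ φ π J) {a b : ℝ} (ha : a ∈ I) (hb : b ∈ I)
    (f : 𝓢(Space, ℂ)) : φ b f
      = φ a (propCos μ (b - a) f) + π a (propSin μ (b - a) f)
        - ∫ r in a..b, J r (propSin μ (b - r) f) := by
  have := h.duhamel hI (α := fun τ => propCos μ τ f) (β := fun τ => propSin μ τ f)
    (fun τ => by rw [kgOp_propSin]; exact hasCurveDerivAt_propCos μ τ f)
    (fun τ => hasCurveDerivAt_propSin μ τ f) ha hb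
  simpa using this

lemma WeakKG.momentum_eq {I : Set ℝ} (hI : I.OrdConnected) {μ : ℝ}
    {φ π J : ℝ → 𝓢(Space, ℂ) →ₗ[ℂ] ℂ} (h : WeakKG I μ φ π J) {a b : ℝ} (ha : a ∈ I) (hb : b ∈ I)
    (f : 𝓢(Space, ℂ)) : π b f
      = φ a (kgOp μ (propSin μ (b - a) f)) + π a (propCos μ (b - a) f)
        - ∫ r in a..b, J r (propCos μ (b - r) f) := by
  have := h.duhamel hI (α := fun τ => kgOp μ (propSin μ τ f)) (β := fun τ => propCos μ τ f)
    (fun τ => (hasCurveDerivAt_propSin μ τ f).clm_apply _)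
    (fun τ => by rw [kgOp_propSin]; exact hasCurveDerivAt_propCos μ τ f) ha hb
  simpa using this

/-! ### Diagonalization of the mass matrix -/

/-- A rotation `(α, β)` with squared masses `μ₁, μ₂` diagonalizing `[[a, g], [g, d]]`. -/
structure MassRotation (a g d α β μ₁ μ₂ : ℝ) : Prop where
  norm : α ^ 2 + β ^ 2 = 1
  eq₁ : a * α + g * β = μ₁ * α
  eq₂ : g * α + d * β = μ₁ * β
  eq₃ : g * α - a * β = -(μ₂ * β)
  eq₄ : d * α - g * β = μ₂ * α

/-- The rotation angle is half the argument of `(a - d) + 2 i g`. The degenerate case `a = d`, `g =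
0` needs no separate treatment, since any angle is then admissible. -/
lemma exists_massRotation (a g d : ℝ) : ∃ α β μ₁ μ₂, MassRotation a g d α β μ₁ μ₂ := by
  set w : ℂ := ⟨a - d, 2 * g⟩ with hw
  set θ := w.arg / 2 with hθ
  set α := Real.cos θ
  set β := Real.sin θ
  have hn : α ^ 2 + β ^ 2 = 1 := Real.cos_sq_add_sin_sq θ
  have hc : α ^ 2 - β ^ 2 = Real.cos w.arg := by
    rw [show w.arg = 2 * θ by rw [hθ]; ring, Real.cos_two_mul']
  have hs : 2 * (α * β) = Real.sin w.arg := by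
    rw [show w.arg = 2 * θ by rw [hθ]; ring, Real.sin_two_mul]; ring
  have h1 : ‖w‖ * Real.cos w.arg = a - d := Complex.norm_mul_cos_arg w
  have h2 : ‖w‖ * Real.sin w.arg = 2 * g := Complex.norm_mul_sin_arg w
  -- Vanishing of the off-diagonal entry of the rotated matrix.
  have hrel : (a - d) * (α * β) = g * (α ^ 2 - β ^ 2) := by
    rw [hc, ← h1]
    linear_combination (‖w‖ * Real.cos w.arg / 2) * hs + (Real.cos w.arg / 2) * h2
  refine ⟨α, β, a * α ^ 2 + 2 * g * α * β + d * β ^ 2, a * β ^ 2 - 2 * g * α * β + d * α ^ 2,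
    hn, ?_, ?_, ?_, ?_⟩
  · linear_combination (-(a * α) - g * β) * hn + β * hrel
  · linear_combination (-(g * α) - d * β) * hn - α * hrel
  · linear_combination (-(g * α) + a * β) * hn - α * hrel
  · linear_combination (-(d * α) + g * β) * hn - β * hrel

/-- Rotation decouples a coupled pair of Klein-Gordon equations. -/
lemma kgOp_rotate {mS mE α β μ : ℝ} {g : ℝ} (h₁ : mS * α + g * β = μ * α)
    (h₂ : g * α + mE * β = μ * β) (φ χ : 𝓢(Space, ℂ) →ₗ[ℂ] ℂ) (f : 𝓢(Space, ℂ)) :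
    (α : ℂ) * (φ (kgOp mS f) - g * χ f) + (β : ℂ) * (χ (kgOp mE f) - g * φ f)
      = (α : ℂ) * φ (kgOp μ f) + (β : ℂ) * χ (kgOp μ f) := by
  have h₁' : (mS : ℂ) * α + g * β = μ * α := by exact_mod_cast h₁
  have h₂' : (g : ℂ) * α + mE * β = μ * β := by exact_mod_cast h₂
  simp only [kgOp_apply, map_sub, map_smul, smul_eq_mul]
  linear_combination (-φ f) * h₁' - (χ f) * h₂'

lemma WeakKG.rotate {I : Set ℝ} {mS mE g α β μ : ℝ} (h₁ : mS * α + g * β = μ * α)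
    (h₂ : g * α + mE * β = μ * β) {φ π χ ρ : ℝ → 𝓢(Space, ℂ) →ₗ[ℂ] ℂ}
    (hφ : WeakKG I mS φ π (fun t => (g : ℂ) • χ t))
    (hχ : WeakKG I mE χ ρ (fun t => (g : ℂ) • φ t)) :
    WeakKG I μ (fun t => (α : ℂ) • φ t + (β : ℂ) • χ t)
      (fun t => (α : ℂ) • π t + (β : ℂ) • ρ t) 0 where
  continuousOn_field := (hφ.continuousOn_field.const_smul (α : ℂ)).add
    (hχ.continuousOn_field.const_smul (β : ℂ))
  continuousOn_momentum := (hφ.continuousOn_momentum.const_smul (α : ℂ)).add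
    (hχ.continuousOn_momentum.const_smul (β : ℂ))
  continuousOn_source := continuousOn_const
  deriv_field f t ht := ((hφ.deriv_field f t ht).const_mul (α : ℂ)).add
    ((hχ.deriv_field f t ht).const_mul (β : ℂ))
  deriv_momentum f t ht := by
    refine (((hφ.deriv_momentum f t ht).const_mul (α : ℂ)).add
      ((hχ.deriv_momentum f t ht).const_mul (β : ℂ))).congr_deriv ?_
    simpa using kgOp_rotate h₁ h₂ (φ t) (χ t) f

/-! ### Matrix elements and free evolution of field operators -/

section operators
variable {D : Type*} [NormedAddCommGroup D] [InnerProductSpace ℂ D]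

/-- The matrix elements of a smeared operator. -/
def matrixElement (A : 𝓢(Space, ℂ) →ₗ[ℂ] Module.End ℂ D) (u v : D) : 𝓢(Space, ℂ) →ₗ[ℂ] ℂ where
  toFun f := ⟪u, A f v⟫_ℂ
  map_add' f h := by simp
  map_smul' c f := by simp

@[simp] lemma matrixElement_apply (A : 𝓢(Space, ℂ) →ₗ[ℂ] Module.End ℂ D) (u v : D)
    (f : 𝓢(Space, ℂ)) : matrixElement A u v f = ⟪u, A f v⟫_ℂ := rfl

lemma end_ext_inner {A B : Module.End ℂ D} (h : ∀ u v : D, ⟪u, A v⟫_ℂ = ⟪u, B v⟫_ℂ) : A = B :=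
  LinearMap.ext fun v => ext_inner_left ℂ fun u => h u v

lemma SatisfiesKG.weakKG {m g : ℝ} {φ χ : ScalarField D} (h : SatisfiesKG m g φ χ) (u v : D) :
    WeakKG univ (m ^ 2) (fun t => matrixElement (φ.field t) u v)
      (fun t => matrixElement (φ.momentum t) u v)
      (fun t => (g : ℂ) • matrixElement (χ.field t) u v) where
  continuousOn_field := (φ.continuous_field u v).continuousOn
  continuousOn_momentum := (φ.continuous_momentum u v).continuousOn
  continuousOn_source := ((χ.continuous_field u v).const_smul (g : ℂ)).continuousOn
  deriv_field f t _ := (φ.hasDerivAt_field u v f t).hasDerivWithinAt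
  deriv_momentum f t _ := by
    have := h u v f t
    rw [kgSpatial_eq] at this
    exact this.hasDerivWithinAt

/-- The operators `φ`, `π` evolve freely with squared mass `μ`. -/
structure FreeEvolution (μ : ℝ) (φ π : ℝ → 𝓢(Space, ℂ) →ₗ[ℂ] Module.End ℂ D) : Prop where
  field_eq : ∀ a b f, φ b f = φ a (propCos μ (b - a) f) + π a (propSin μ (b - a) f)
  momentum_eq : ∀ a b f,
    π b f = φ a (kgOp μ (propSin μ (b - a) f)) + π a (propCos μ (b - a) f)

lemma freeEvolution_of_weakKG {μ : ℝ} {φ π : ℝ → 𝓢(Space, ℂ) →ₗ[ℂ] Module.End ℂ D}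
    (h : ∀ u v, WeakKG univ μ (fun t => matrixElement (φ t) u v)
      (fun t => matrixElement (π t) u v) 0) : FreeEvolution μ φ π where
  field_eq a b f := end_ext_inner fun u v => by
    have := (h u v).field_eq ordConnected_univ (mem_univ a) (mem_univ b) f
    simpa [inner_add_right] using this
  momentum_eq a b f := end_ext_inner fun u v => by
    have := (h u v).momentum_eq ordConnected_univ (mem_univ a) (mem_univ b) f
    simpa [inner_add_right] using this

/-- The combination `α A + β B` of two time-dependent smeared operators. -/
def rotateOp (α β : ℝ) (A B : ℝ → 𝓢(Space, ℂ) →ₗ[ℂ] Module.End ℂ D) (t : ℝ) :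
    𝓢(Space, ℂ) →ₗ[ℂ] Module.End ℂ D := (α : ℂ) • A t + (β : ℂ) • B t

/-- An eigenvector `(α, β)` of the mass matrix decouples the equations of motion, so the matrix
elements of this combination obey Duhamel's formula without source; equality of all matrix elements
gives operator identities. -/
lemma CoupledModel.freeEvolution {mS mE g t₀ α β μ : ℝ} {S E : ScalarField D}
    (h : CoupledModel mS mE g t₀ S E) (h₁ : mS ^ 2 * α + g * β = μ * α)
    (h₂ : g * α + mE ^ 2 * β = μ * β) :
    FreeEvolution μ (rotateOp α β S.field E.field) (rotateOp α β S.momentum E.momentum) := by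
  refine freeEvolution_of_weakKG fun u v => ?_
  convert (h.eom_system.weakKG u v).rotate h₁ h₂ (h.eom_environment.weakKG u v) using 1 <;>
  · ext t f
    simp [rotateOp]

/-! ### Canonical commutation relations along the evolution -/

section bracket
variable (A B C : Module.End ℂ D) (c : ℂ)

lemma bracket_skew : -⁅B, A⁆ = ⁅A, B⁆ := by simp [Ring.lie_def]

@[simp] lemma add_bracket : ⁅A + B, C⁆ = ⁅A, C⁆ + ⁅B, C⁆ := by
  simp only [Ring.lie_def, add_mul, mul_add]; abel

@[simp] lemma bracket_add : ⁅A, B + C⁆ = ⁅A, B⁆ + ⁅A, C⁆ := by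
  simp only [Ring.lie_def, add_mul, mul_add]; abel

@[simp] lemma smul_bracket : ⁅c • A, B⁆ = c • ⁅A, B⁆ := by
  simp [Ring.lie_def, smul_sub]

@[simp] lemma bracket_smul : ⁅A, c • B⁆ = c • ⁅A, B⁆ := by
  simp [Ring.lie_def, smul_sub]

end bracket

/-- Canonical commutators, up to the scalar `c`, between two sets of Cauchy data. -/
structure CrossCCR (c : ℂ) (φ₁ π₁ φ₂ π₂ : 𝓢(Space, ℂ) →ₗ[ℂ] Module.End ℂ D) : Prop where
  field_field : ∀ f h, ⁅φ₁ f, φ₂ h⁆ = 0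
  momentum_momentum : ∀ f h, ⁅π₁ f, π₂ h⁆ = 0
  field_momentum : ∀ f h : 𝓢(Space, ℂ),
    ⁅φ₁ f, π₂ h⁆ = (c * ∫ x, f x * h x) • (1 : Module.End ℂ D)
  momentum_field : ∀ f h : 𝓢(Space, ℂ),
    ⁅π₁ f, φ₂ h⁆ = (-(c * ∫ x, f x * h x)) • (1 : Module.End ℂ D)

lemma EqualTimeCCR.crossCCR {A : ScalarField D} {t : ℝ} (h : EqualTimeCCR A t) :
    CrossCCR Complex.I (A.field t) (A.momentum t) (A.field t) (A.momentum t) where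
  field_field := h.field_field
  momentum_momentum := h.momentum_momentum
  field_momentum := h.field_momentum
  momentum_field f k := by
    rw [← bracket_skew, h.field_momentum, neg_smul]
    simp only [mul_comm]

lemma EqualTimeCommute.crossCCR {A B : ScalarField D} {t : ℝ} (h : EqualTimeCommute A B t) :
    CrossCCR 0 (A.field t) (A.momentum t) (B.field t) (B.momentum t) where
  field_field := h.field_field
  momentum_momentum := h.momentum_momentum
  field_momentum f k := by simp [h.field_momentum]
  momentum_field f k := by simp [h.momentum_field]

lemma CrossCCR.symm_zero {φ₁ π₁ φ₂ π₂ : 𝓢(Space, ℂ) →ₗ[ℂ] Module.End ℂ D}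
    (h : CrossCCR 0 φ₁ π₁ φ₂ π₂) : CrossCCR 0 φ₂ π₂ φ₁ π₁ where
  field_field f k := by rw [← bracket_skew, h.field_field, neg_zero]
  momentum_momentum f k := by rw [← bracket_skew, h.momentum_momentum, neg_zero]
  field_momentum f k := by rw [← bracket_skew, h.momentum_field]; simp
  momentum_field f k := by rw [← bracket_skew, h.field_momentum]; simp

lemma CrossCCR.rotate {c₁₁ c₁₂ c₂₁ c₂₂ : ℂ} (α β α' β' : ℝ)
    {φ₁ π₁ φ₂ π₂ ψ₁ ρ₁ ψ₂ ρ₂ : ℝ → 𝓢(Space, ℂ) →ₗ[ℂ] Module.End ℂ D} {t : ℝ}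
    (h₁₁ : CrossCCR c₁₁ (φ₁ t) (π₁ t) (ψ₁ t) (ρ₁ t))
    (h₁₂ : CrossCCR c₁₂ (φ₁ t) (π₁ t) (ψ₂ t) (ρ₂ t))
    (h₂₁ : CrossCCR c₂₁ (φ₂ t) (π₂ t) (ψ₁ t) (ρ₁ t))
    (h₂₂ : CrossCCR c₂₂ (φ₂ t) (π₂ t) (ψ₂ t) (ρ₂ t)) :
    CrossCCR (α * α' * c₁₁ + α * β' * c₁₂ + β * α' * c₂₁ + β * β' * c₂₂)
      (rotateOp α β φ₁ φ₂ t) (rotateOp α β π₁ π₂ t)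
      (rotateOp α' β' ψ₁ ψ₂ t) (rotateOp α' β' ρ₁ ρ₂ t) where
  field_field f k := by
    simp only [rotateOp, LinearMap.add_apply, LinearMap.smul_apply, add_bracket, bracket_add,
      smul_bracket, bracket_smul, h₁₁.field_field, h₁₂.field_field, h₂₁.field_field,
      h₂₂.field_field, smul_zero, add_zero]
  momentum_momentum f k := by
    simp only [rotateOp, LinearMap.add_apply, LinearMap.smul_apply, add_bracket, bracket_add,
      smul_bracket, bracket_smul, h₁₁.momentum_momentum, h₁₂.momentum_momentum,
      h₂₁.momentum_momentum, h₂₂.momentum_momentum, smul_zero, add_zero]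
  field_momentum f k := by
    simp only [rotateOp, LinearMap.add_apply, LinearMap.smul_apply, add_bracket, bracket_add, smul_bracket,
      bracket_smul, h₁₁.field_momentum, h₁₂.field_momentum, h₂₁.field_momentum, h₂₂.field_momentum]
    module
  momentum_field f k := by
    simp only [rotateOp, LinearMap.add_apply, LinearMap.smul_apply, add_bracket, bracket_add, smul_bracket,
      bracket_smul, h₁₁.momentum_field, h₁₂.momentum_field, h₂₁.momentum_field, h₂₂.momentum_field]
    module

/-- This is cos² + sin² = 1, with `kgOp μ` in the role of -ω². -/
lemma propCos_propCos_sub (μ t : ℝ) (f : 𝓢(Space, ℂ)) :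
    propCos μ t (propCos μ t f) - propSin μ t (kgOp μ (propSin μ t f)) = f := by
  have h := propCos_add μ t (-t) f
  rw [add_neg_cancel, propCos_zero, propCos_neg, propSin_neg, map_neg, ← kgOp_propSin] at h
  rw [sub_eq_add_neg]; exact h.symm

lemma propCos_kgOp_propSin (μ t : ℝ) (f : 𝓢(Space, ℂ)) :
    propCos μ t (kgOp μ (propSin μ t f)) = propSin μ t (kgOp μ (propCos μ t f)) := by
  have hs := hasTemperateGrowth_oscSin μ t
  have hc := hasTemperateGrowth_oscCos μ t
  have hk := hasTemperateGrowth_neg_dispersion μ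
  simp only [propSin, propCos, kgOp]
  rw [← multiplier_mul hk hs, ← multiplier_mul hc (hasTemperateGrowth_mul hk hs),
    ← multiplier_mul hk hc, ← multiplier_mul hs (hasTemperateGrowth_mul hk hc)]
  congr 2; ext k; ring

variable {φ π φ' π' : ℝ → 𝓢(Space, ℂ) →ₗ[ℂ] Module.End ℂ D}

lemma integrable_mul_schwartz (f h : 𝓢(Space, ℂ)) : Integrable fun x => f x * h x :=
  (SchwartzMap.pairing (ContinuousLinearMap.mul ℂ ℂ) f h).integrable

lemma integral_sub_mul (f k h : 𝓢(Space, ℂ)) :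
    ∫ x, (f - k) x * h x = (∫ x, f x * h x) - ∫ x, k x * h x := by
  rw [← integral_sub (integrable_mul_schwartz _ _) (integrable_mul_schwartz _ _)]
  simp [sub_mul]

lemma integral_propCos_mul_propCos_sub (μ t : ℝ) (f h : 𝓢(Space, ℂ)) :
    (∫ x, propCos μ t f x * propCos μ t h x)
      - ∫ x, propSin μ t f x * kgOp μ (propSin μ t h) x = ∫ x, f x * h x := by
  rw [← integral_propCos_mul, ← integral_kgOp_mul, ← integral_propSin_mul, ← integral_sub_mul,
    propCos_propCos_sub]

/-- The commutator of free fields at different times. -/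
lemma CrossCCR.commutator {c : ℂ} {μ t₀ : ℝ} (h₁ : FreeEvolution μ φ π)
    (h₂ : FreeEvolution μ φ' π') (h : CrossCCR c (φ t₀) (π t₀) (φ' t₀) (π' t₀)) (s t : ℝ)
    (f k : 𝓢(Space, ℂ)) :
    ⁅φ s f, φ' t k⁆ = (-(c * ∫ x, propSin μ (s - t) f x * k x)) • (1 : Module.End ℂ D) := by
  rw [h₁.field_eq t₀ s, h₂.field_eq t₀ t]
  simp only [add_bracket, bracket_add, h.field_field, h.momentum_momentum, h.field_momentum,
    h.momentum_field, zero_add, add_zero]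
  rw [← add_smul]
  congr 1
  -- Once all propagators are moved onto `f`, the two surviving terms combine by the subtraction
  -- formula for the sine, and `t₀` drops out.
  have e₁ := integral_propCos_mul μ (t - t₀) (propSin μ (s - t₀) f) k
  have e₂ := integral_propSin_mul μ (t - t₀) (propCos μ (s - t₀) f) k
  rw [show s - t = (s - t₀) - (t - t₀) by ring, propSin_sub μ (s - t₀) (t - t₀),
    integral_sub_mul, e₁, e₂]
  ring

/-- Free evolution preserves canonical commutation relations. -/
lemma CrossCCR.evolve {c : ℂ} {μ t₀ : ℝ} (h₁ : FreeEvolution μ φ π)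
    (h₂ : FreeEvolution μ φ' π') (h : CrossCCR c (φ t₀) (π t₀) (φ' t₀) (π' t₀)) (t : ℝ) :
    CrossCCR c (φ t) (π t) (φ' t) (π' t) where
  field_field f k := by rw [h.commutator h₁ h₂]; simp
  momentum_momentum f k := by
    rw [h₁.momentum_eq t₀ t, h₂.momentum_eq t₀ t]
    simp only [add_bracket, bracket_add, h.field_field, h.momentum_momentum, h.field_momentum,
      h.momentum_field, zero_add, add_zero]
    rw [← add_smul, ← integral_propCos_mul, ← integral_kgOp_mul, ← integral_propSin_mul,
      propCos_kgOp_propSin]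
    simp
  field_momentum f k := by
    rw [h₁.field_eq t₀ t, h₂.momentum_eq t₀ t]
    simp only [add_bracket, bracket_add, h.field_field, h.momentum_momentum, h.field_momentum,
      h.momentum_field, zero_add, add_zero]
    rw [← add_smul, ← integral_propCos_mul_propCos_sub μ (t - t₀) f k]
    congr 1; ring
  momentum_field f k := by
    rw [h₁.momentum_eq t₀ t, h₂.field_eq t₀ t]
    simp only [add_bracket, bracket_add, h.field_field, h.momentum_momentum, h.field_momentum,
      h.momentum_field, zero_add, add_zero]
    rw [← add_smul, ← integral_propCos_mul_propCos_sub μ (t - t₀) f k, integral_kgOp_mul]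
    congr 1; ring

/-- With constant `0` each term vanishes separately, so the two fields may have different masses.
This disposes of the cross terms between normal modes. -/
lemma CrossCCR.commutator_zero {μ μ' t₀ : ℝ} (h₁ : FreeEvolution μ φ π)
    (h₂ : FreeEvolution μ' φ' π') (h : CrossCCR 0 (φ t₀) (π t₀) (φ' t₀) (π' t₀)) (s t : ℝ)
    (f k : 𝓢(Space, ℂ)) : ⁅φ s f, φ' t k⁆ = 0 := by
  rw [h₁.field_eq t₀ s, h₂.field_eq t₀ t]
  simp [h.field_field, h.momentum_momentum, h.field_momentum, h.momentum_field]

lemma CrossCCR.evolve_zero {μ μ' t₀ : ℝ} (h₁ : FreeEvolution μ φ π)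
    (h₂ : FreeEvolution μ' φ' π') (h : CrossCCR 0 (φ t₀) (π t₀) (φ' t₀) (π' t₀)) (t : ℝ) :
    CrossCCR 0 (φ t) (π t) (φ' t) (π' t) := by
  constructor <;> intro f k <;>
  simp [h₁.field_eq t₀ t, h₂.field_eq t₀ t, h₁.momentum_eq t₀ t, h₂.momentum_eq t₀ t,
    h.field_field, h.momentum_momentum, h.field_momentum, h.momentum_field]

/-! ### The coupled model in terms of its normal modes -/

/-- The system-system propagator of the coupled model. -/
def systemProp (α β μ₁ μ₂ τ : ℝ) : 𝓢(Space, ℂ) →L[ℂ] 𝓢(Space, ℂ) :=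
  ((α ^ 2 : ℝ) : ℂ) • propSin μ₁ τ + ((β ^ 2 : ℝ) : ℂ) • propSin μ₂ τ

section model
variable {mS mE g t₀ α β μ₁ μ₂ : ℝ} {S E : ScalarField D}

lemma MassRotation.system_eq (hr : MassRotation (mS ^ 2) g (mE ^ 2) α β μ₁ μ₂)
    (A B : ℝ → 𝓢(Space, ℂ) →ₗ[ℂ] Module.End ℂ D) :
    A = rotateOp α (-β) (rotateOp α β A B) (rotateOp (-β) α A B) := by
  ext t f : 2
  have h : (α : ℂ) ^ 2 + (β : ℂ) ^ 2 = 1 := by exact_mod_cast hr.norm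
  simp only [rotateOp, LinearMap.add_apply, LinearMap.smul_apply, Complex.ofReal_neg]
  calc A t f = ((α : ℂ) ^ 2 + (β : ℂ) ^ 2) • A t f := by rw [h, one_smul]
    _ = _ := by module

lemma CoupledModel.freeEvolution₁ (hm : CoupledModel mS mE g t₀ S E)
    (hr : MassRotation (mS ^ 2) g (mE ^ 2) α β μ₁ μ₂) :
    FreeEvolution μ₁ (rotateOp α β S.field E.field) (rotateOp α β S.momentum E.momentum) :=
  hm.freeEvolution hr.eq₁ hr.eq₂

lemma CoupledModel.freeEvolution₂ (hm : CoupledModel mS mE g t₀ S E)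
    (hr : MassRotation (mS ^ 2) g (mE ^ 2) α β μ₁ μ₂) :
    FreeEvolution μ₂ (rotateOp (-β) α S.field E.field)
      (rotateOp (-β) α S.momentum E.momentum) :=
  hm.freeEvolution (by linear_combination hr.eq₃) (by linear_combination hr.eq₄)

/-- Commutators of linear combinations see only the inner product of the coefficient vectors.
Orthonormal combinations are therefore canonical and commute with one another. -/
lemma CoupledModel.crossCCR (hm : CoupledModel mS mE g t₀ S E) (a b a' b' : ℝ) :
    CrossCCR (((a * a' + b * b' : ℝ) : ℂ) * Complex.I)
      (rotateOp a b S.field E.field t₀) (rotateOp a b S.momentum E.momentum t₀)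
      (rotateOp a' b' S.field E.field t₀) (rotateOp a' b' S.momentum E.momentum t₀) := by
  have h := CrossCCR.rotate a b a' b' hm.ccr_system.crossCCR hm.commute.crossCCR
    hm.commute.crossCCR.symm_zero hm.ccr_environment.crossCCR
  convert h using 1
  push_cast; ring

lemma CoupledModel.crossCCR₁₁ (hm : CoupledModel mS mE g t₀ S E)
    (hr : MassRotation (mS ^ 2) g (mE ^ 2) α β μ₁ μ₂) :
    CrossCCR Complex.I
      (rotateOp α β S.field E.field t₀) (rotateOp α β S.momentum E.momentum t₀)
      (rotateOp α β S.field E.field t₀) (rotateOp α β S.momentum E.momentum t₀) := by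
  have h := hm.crossCCR α β α β
  rwa [show α * α + β * β = 1 by linear_combination hr.norm, Complex.ofReal_one, one_mul] at h

lemma CoupledModel.crossCCR₂₂ (hm : CoupledModel mS mE g t₀ S E)
    (hr : MassRotation (mS ^ 2) g (mE ^ 2) α β μ₁ μ₂) :
    CrossCCR Complex.I
      (rotateOp (-β) α S.field E.field t₀) (rotateOp (-β) α S.momentum E.momentum t₀)
      (rotateOp (-β) α S.field E.field t₀) (rotateOp (-β) α S.momentum E.momentum t₀) := by
  have h := hm.crossCCR (-β) α (-β) α
  rwa [show -β * -β + α * α = 1 by linear_combination hr.norm, Complex.ofReal_one, one_mul] at h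

lemma CoupledModel.crossCCR₁₂ (hm : CoupledModel mS mE g t₀ S E) (α β : ℝ) :
    CrossCCR 0
      (rotateOp α β S.field E.field t₀) (rotateOp α β S.momentum E.momentum t₀)
      (rotateOp (-β) α S.field E.field t₀) (rotateOp (-β) α S.momentum E.momentum t₀) := by
  have h := hm.crossCCR α β (-β) α
  rwa [show α * -β + β * α = 0 by ring, Complex.ofReal_zero, zero_mul] at h

/-- At `t₀` the two normal modes are canonical and mutually commuting; free evolution preserves both
properties, and the inverse rotation at time `t` returns the relations of the system. -/
lemma CoupledModel.equalTimeCCR (hm : CoupledModel mS mE g t₀ S E) (t : ℝ) :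
    EqualTimeCCR S t := by
  obtain ⟨α, β, μ₁, μ₂, hr⟩ := exists_massRotation (mS ^ 2) g (mE ^ 2)
  have f₁ := hm.freeEvolution₁ hr
  have f₂ := hm.freeEvolution₂ hr
  have h₁₂ := (hm.crossCCR₁₂ α β).evolve_zero f₁ f₂ t
  have h := CrossCCR.rotate α (-β) α (-β) ((hm.crossCCR₁₁ hr).evolve f₁ f₁ t) h₁₂ h₁₂.symm_zero
    ((hm.crossCCR₂₂ hr).evolve f₂ f₂ t)
  rw [← hr.system_eq, ← hr.system_eq] at h
  have hc : (α * α * Complex.I + α * (-β : ℝ) * 0 + (-β : ℝ) * α * 0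
      + (-β : ℝ) * (-β : ℝ) * Complex.I : ℂ) = Complex.I := by
    have : (α : ℂ) ^ 2 + (β : ℂ) ^ 2 = 1 := by exact_mod_cast hr.norm
    push_cast
    linear_combination Complex.I * this
  rw [hc] at h
  exact ⟨h.field_field, h.momentum_momentum, h.field_momentum⟩

/-- The system is `α` times the first mode minus `β` times the second. The cross commutators vanish,
and each mode contributes `-I` times its kernel, with weight α² or β². -/
lemma CoupledModel.commutator (hm : CoupledModel mS mE g t₀ S E)
    (hr : MassRotation (mS ^ 2) g (mE ^ 2) α β μ₁ μ₂) (s t : ℝ) (f k : 𝓢(Space, ℂ)) :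
    Complex.I • ⁅S.field s f, S.field t k⁆
      = (∫ x, systemProp α β μ₁ μ₂ (s - t) f x * k x) • (1 : Module.End ℂ D) := by
  have f₁ := hm.freeEvolution₁ hr
  have f₂ := hm.freeEvolution₂ hr
  have c₁₁ := (hm.crossCCR₁₁ hr).commutator f₁ f₁ s t f k
  have c₂₂ := (hm.crossCCR₂₂ hr).commutator f₂ f₂ s t f k
  have c₁₂ := (hm.crossCCR₁₂ α β).commutator_zero f₁ f₂ s t f k
  have c₂₁ := (hm.crossCCR₁₂ α β).symm_zero.commutator_zero f₂ f₁ s t f k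
  have hint : ∫ x, systemProp α β μ₁ μ₂ (s - t) f x * k x
      = (α : ℂ) ^ 2 * (∫ x, propSin μ₁ (s - t) f x * k x)
        + (β : ℂ) ^ 2 * ∫ x, propSin μ₂ (s - t) f x * k x := by
    rw [← integral_const_mul, ← integral_const_mul,
      ← integral_add ((integrable_mul_schwartz _ _).const_mul _)
        ((integrable_mul_schwartz _ _).const_mul _)]
    refine integral_congr_ae (.of_forall fun x => ?_)
    simp [systemProp]
    ring
  rw [hr.system_eq S.field E.field]
  generalize rotateOp α β S.field E.field = A at *
  generalize rotateOp (-β) α S.field E.field = B at *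
  rw [rotateOp, rotateOp]
  simp only [LinearMap.add_apply, LinearMap.smul_apply, add_bracket, bracket_add, smul_bracket,
    bracket_smul, c₁₁, c₁₂, c₂₁, c₂₂, smul_zero, add_zero, zero_add, smul_smul, ← add_smul]
  congr 1
  rw [hint]
  push_cast
  linear_combination (-(α : ℂ) ^ 2 * (∫ x, propSin μ₁ (s - t) f x * k x)
        - (β : ℂ) ^ 2 * ∫ x, propSin μ₂ (s - t) f x * k x) * Complex.I_sq

/-- The memory integral only involves the past. -/
lemma integral_memoryKernel (mE g : ℝ) (F : ℝ → 𝓢(Space, ℂ) →ₗ[ℂ] ℂ) (f : 𝓢(Space, ℂ)) {t s : ℝ}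
    (ht : t ≤ s) : ∫ r in Ici t, F r (memoryKernel mE g (s - r) f)
      = -(g : ℂ) ^ 2 * ∫ r in t..s, F r (propSin (mE ^ 2) (s - r) f) := by
  rw [intervalIntegral.integral_of_le ht, ← integral_Icc_eq_integral_Ioc, ← integral_const_mul,
    ← Ici_inter_Iic, ← setIntegral_indicator measurableSet_Iic]
  refine integral_congr_ae (.of_forall fun r => ?_)
  by_cases hr : r ≤ s
  · simp [memoryKernel, retardedGreen, hr, kgSin_eq]
  · simp [memoryKernel, retardedGreen, hr]

/-- Elimination of the environment. -/
lemma CoupledModel.satisfiesLangevin (hm : CoupledModel mS mE g t₀ S E) :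
    SatisfiesLangevin mS mE g t₀ S E := by
  intro u v f t ht
  refine (hm.eom_system u v f t).congr_deriv ?_
  -- Duhamel's formula with source `g φ_S`: the Cauchy data evolve into the in-field, hence the
  -- noise, and the source integral becomes the memory term.
  have h := (hm.eom_environment.weakKG u v).field_eq ordConnected_univ (mem_univ t₀)
    (mem_univ t) f
  have hmem := integral_memoryKernel mE g (fun r => matrixElement (S.field r) u v) f ht
  simp only [matrixElement_apply] at hmem
  rw [hmem]
  simp only [matrixElement_apply, LinearMap.smul_apply, smul_eq_mul,
    intervalIntegral.integral_const_mul] at h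
  rw [h]
  simp only [noise, inField, kgCos_eq, kgSin_eq, LinearMap.smul_apply, LinearMap.add_apply,
    inner_smul_right, inner_add_right]
  ring

end model
end operators

/-! ### Existence for the causal Volterra equation -/

lemma HasCurveDerivAt.hasDerivAt_clm {F : Type*} [NormedAddCommGroup F] [NormedSpace ℂ F]
    {ψ : ℝ → 𝓢(Space, ℂ)} {ψ' : 𝓢(Space, ℂ)} {t : ℝ}
    (h : HasCurveDerivAt ψ ψ' t) (L : 𝓢(Space, ℂ) →L[ℂ] F) :
    HasDerivAt (fun s => L (ψ s)) (L ψ') t := by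
  rw [hasDerivAt_iff_tendsto_slope]
  refine ((L.continuous.tendsto _).comp h).congr fun s => ?_
  simp only [Function.comp_apply, slope_def_module, map_smul, map_sub]
  rw [← Complex.ofReal_inv, Complex.coe_smul]

lemma HasCurveDerivAt.comp_sub_const {ψ : ℝ → 𝓢(Space, ℂ)} {ψ' : 𝓢(Space, ℂ)} {b t : ℝ}
    (h : HasCurveDerivAt ψ ψ' (t - b)) : HasCurveDerivAt (fun s => ψ (s - b)) ψ' t := by
  have hs : Tendsto (fun s : ℝ => s - b) (𝓝[≠] t) (𝓝[≠] (t - b)) := by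
    refine tendsto_nhdsWithin_of_tendsto_nhds_of_eventually_within _ ?_ ?_
    · exact Tendsto.mono_left (Continuous.tendsto (f := fun s : ℝ => s - b) (by fun_prop) t)
        nhdsWithin_le_nhds
    · filter_upwards [self_mem_nhdsWithin] with s hs
      intro h'
      exact hs (by simpa using h')
  refine (h.comp hs).congr fun s => ?_
  simp

/-- The free solution whose data at time `t` are zero field and velocity `L`. -/
lemma weakKG_prop (L : 𝓢(Space, ℂ) →L[ℂ] ℂ) (μ t : ℝ) :
    WeakKG univ μ (fun s => (L ∘L propSin μ (s - t)).toLinearMap)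
      (fun s => (L ∘L propCos μ (s - t)).toLinearMap) 0 where
  continuousOn_field := (L.continuous.comp ((continuous_propSin μ).comp
    ((continuous_fst.sub continuous_const).prodMk continuous_snd))).continuousOn
  continuousOn_momentum := (L.continuous.comp ((continuous_propCos μ).comp
    ((continuous_fst.sub continuous_const).prodMk continuous_snd))).continuousOn
  continuousOn_source := continuousOn_const
  deriv_field f s _ :=
    ((hasCurveDerivAt_propSin μ (s - t) f).comp_sub_const.hasDerivAt_clm L).hasDerivWithinAt
  deriv_momentum f s _ := by
    have h := ((hasCurveDerivAt_propCos μ (s - t) f).comp_sub_const.hasDerivAt_clm L)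
    simpa using h

/-- Superposition of two free solutions with different masses. -/
lemma WeakKG.superpose {I : Set ℝ} {μ₁ μ₂ : ℝ} {φ₁ π₁ φ₂ π₂ : ℝ → 𝓢(Space, ℂ) →ₗ[ℂ] ℂ}
    (h₁ : WeakKG I μ₁ φ₁ π₁ 0) (h₂ : WeakKG I μ₂ φ₂ π₂ 0) (a b m : ℝ) :
    WeakKG I m (fun t => (a : ℂ) • φ₁ t + (b : ℂ) • φ₂ t)
      (fun t => (a : ℂ) • π₁ t + (b : ℂ) • π₂ t)
      (fun t => (((μ₁ - m) * a : ℝ) : ℂ) • φ₁ t + (((μ₂ - m) * b : ℝ) : ℂ) • φ₂ t) where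
  continuousOn_field := (h₁.continuousOn_field.const_smul (a : ℂ)).add
    (h₂.continuousOn_field.const_smul (b : ℂ))
  continuousOn_momentum := (h₁.continuousOn_momentum.const_smul (a : ℂ)).add
    (h₂.continuousOn_momentum.const_smul (b : ℂ))
  continuousOn_source := (h₁.continuousOn_field.const_smul _).add
    (h₂.continuousOn_field.const_smul _)
  deriv_field f t ht := ((h₁.deriv_field f t ht).const_mul (a : ℂ)).add
    ((h₂.deriv_field f t ht).const_mul (b : ℂ))
  deriv_momentum f t ht := by
    refine (((h₁.deriv_momentum f t ht).const_mul (a : ℂ)).add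
      ((h₂.deriv_momentum f t ht).const_mul (b : ℂ))).congr_deriv ?_
    simp only [kgOp_apply, map_sub, map_smul, smul_eq_mul, Pi.zero_apply, LinearMap.zero_apply,
      LinearMap.add_apply, LinearMap.smul_apply]
    push_cast
    ring

/-- The velocity of `systemProp`. -/
def systemPropDeriv (α β μ₁ μ₂ τ : ℝ) : 𝓢(Space, ℂ) →L[ℂ] 𝓢(Space, ℂ) :=
  ((α ^ 2 : ℝ) : ℂ) • propCos μ₁ τ + ((β ^ 2 : ℝ) : ℂ) • propCos μ₂ τ

/-- Smearing with a test function, as a tempered distribution. -/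
def smear : 𝓢(Space, ℂ) →L[ℂ] 𝓢'(Space, ℂ) := SchwartzMap.toTemperedDistributionCLM Space ℂ volume

lemma smear_apply (h f : 𝓢(Space, ℂ)) : smear h f = ∫ x, f x * h x := by
  simp [smear]

/-- The commutator function `Δ_S` of the system. -/
def commutatorFunction (α β μ₁ μ₂ s t : ℝ) : 𝓢(Space, ℂ) →L[ℂ] 𝓢'(Space, ℂ) :=
  smear ∘L systemProp α β μ₁ μ₂ (s - t)

section
variable (α β μ₁ μ₂ τ : ℝ) (f h : 𝓢(Space, ℂ))

lemma smear_comb (p q : 𝓢(Space, ℂ)) (a b : ℂ) :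
    smear (a • p + b • q) f = a * smear p f + b * smear q f := by
  simp only [smear_apply]
  rw [← integral_const_mul, ← integral_const_mul,
    ← integral_add ((integrable_mul_schwartz _ _).const_mul _)
      ((integrable_mul_schwartz _ _).const_mul _)]
  refine integral_congr_ae (.of_forall fun x => ?_)
  simp only [add_apply, smul_apply, smul_eq_mul]
  ring

lemma smear_systemProp : smear (systemProp α β μ₁ μ₂ τ h) f
    = ((α ^ 2 : ℝ) : ℂ) * smear h (propSin μ₁ τ f) + ((β ^ 2 : ℝ) : ℂ) * smear h (propSin μ₂ τ f) := by
  have := smear_comb f (propSin μ₁ τ h) (propSin μ₂ τ h) ((α ^ 2 : ℝ) : ℂ) ((β ^ 2 : ℝ) : ℂ)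
  simp only [smear_apply, integral_propSin_mul] at this ⊢
  exact this

lemma smear_systemPropDeriv : smear (systemPropDeriv α β μ₁ μ₂ τ h) f
    = ((α ^ 2 : ℝ) : ℂ) * smear h (propCos μ₁ τ f) + ((β ^ 2 : ℝ) : ℂ) * smear h (propCos μ₂ τ f) := by
  have := smear_comb f (propCos μ₁ τ h) (propCos μ₂ τ h) ((α ^ 2 : ℝ) : ℂ) ((β ^ 2 : ℝ) : ℂ)
  simp only [smear_apply, integral_propCos_mul] at this ⊢
  exact this

/-- The definition lets the propagator act on `h`, the commutator computation on `f`; symmetry of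
the propagators reconciles the two. -/
lemma commutatorFunction_apply (s t : ℝ) : commutatorFunction α β μ₁ μ₂ s t h f
    = ∫ x, systemProp α β μ₁ μ₂ (s - t) f x * h x := by
  have h1 := smear_systemProp α β μ₁ μ₂ (s - t) f h
  have h2 := smear_comb h (propSin μ₁ (s - t) f) (propSin μ₂ (s - t) f)
    ((α ^ 2 : ℝ) : ℂ) ((β ^ 2 : ℝ) : ℂ)
  simp only [smear_apply] at h1 h2
  rw [commutatorFunction]
  simp only [ContinuousLinearMap.comp_apply, smear_apply]
  rw [h1]
  simp only [mul_comm (h _)] at h2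
  exact h2.symm

end

/-- Continuous linear functional underlying a tempered distribution. -/
def distCLM (w : 𝓢'(Space, ℂ)) : 𝓢(Space, ℂ) →L[ℂ] ℂ where
  toFun f := w f
  map_add' := map_add w
  map_smul' := map_smul w
  cont := map_continuous w

/-- The kernel with weights α², β² and the mixed one with weights αβ, -αβ form a solution of the
coupled equations, each being `g` times the source of the other. Solving the mixed equation by
Duhamel and substituting produces the memory term. -/
lemma MassRotation.isCausalVolterraSolution {mS mE g α β μ₁ μ₂ : ℝ}
    (hr : MassRotation (mS ^ 2) g (mE ^ 2) α β μ₁ μ₂) (t : ℝ) (h : 𝓢(Space, ℂ)) :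
    IsCausalVolterraSolution mS mE g t h (fun s => commutatorFunction α β μ₁ μ₂ s t h) := by
  set L := distCLM (smear h) with hL
  have h₁ := weakKG_prop L μ₁ t
  have h₂ := weakKG_prop L μ₂ t
  have hS := h₁.superpose h₂ (α ^ 2) (β ^ 2) (mS ^ 2)
  have hE := h₁.superpose h₂ (α * β) (-(α * β)) (mE ^ 2)
  -- The eigenvector equations turn the mismatch of masses into the coupling to the other kernel.
  have e₁ : (μ₁ - mS ^ 2) * α ^ 2 = g * (α * β) := by linear_combination (-α) * hr.eq₁
  have e₂ : (μ₂ - mS ^ 2) * β ^ 2 = g * (-(α * β)) := by linear_combination β * hr.eq₃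
  have e₃ : (μ₁ - mE ^ 2) * (α * β) = g * α ^ 2 := by linear_combination (-α) * hr.eq₂
  have e₄ : (μ₂ - mE ^ 2) * (-(α * β)) = g * β ^ 2 := by linear_combination β * hr.eq₄
  rw [e₁, e₂] at hS
  rw [e₃, e₄] at hE
  have hw : ∀ s f, commutatorFunction α β μ₁ μ₂ s t h f = ((α ^ 2 : ℝ) : ℂ) * L (propSin μ₁ (s - t) f)
      + ((β ^ 2 : ℝ) : ℂ) * L (propSin μ₂ (s - t) f) :=
    fun s f => smear_systemProp α β μ₁ μ₂ (s - t) f h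
  have hp : ∀ s f, smear (systemPropDeriv α β μ₁ μ₂ (s - t) h) f
      = ((α ^ 2 : ℝ) : ℂ) * L (propCos μ₁ (s - t) f)
      + ((β ^ 2 : ℝ) : ℂ) * L (propCos μ₂ (s - t) f) :=
    fun s f => smear_systemPropDeriv α β μ₁ μ₂ (s - t) f h
  refine ⟨fun s => smear (systemPropDeriv α β μ₁ μ₂ (s - t) h), ?_, ?_, fun f s hs => ?_,
    fun f s hs => ?_, fun f => ?_, fun f => ?_⟩
  · simp only [hw]
    exact hS.continuousOn_field.mono (prod_mono_left (subset_univ _))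
  · simp only [hp]
    exact hS.continuousOn_momentum.mono (prod_mono_left (subset_univ _))
  · simp only [hw, hp]
    exact (hS.deriv_field f s (mem_univ s)).mono (subset_univ _)
  · have hmem := integral_memoryKernel mE g
      (fun r => (distCLM (commutatorFunction α β μ₁ μ₂ r t h)).toLinearMap) f hs
    have hmem' : ∫ r in Ici t, commutatorFunction α β μ₁ μ₂ r t h (memoryKernel mE g (s - r) f)
      = -(g : ℂ) ^ 2 * ∫ r in t..s, commutatorFunction α β μ₁ μ₂ r t h
        (propSin (mE ^ 2) (s - r) f) := hmem
    have hD := (hS.deriv_momentum f s (mem_univ s)).mono (subset_univ (Ici t))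
    rw [hmem', kgSpatial_eq]
    simp only [hw, hp]
    refine hD.congr_deriv ?_
    -- The weights αβ and -αβ cancel in the Cauchy data at time `t`, so only the source integral
    -- remains.
    have hduh := hE.field_eq ordConnected_univ (mem_univ t) (mem_univ s) f
    have hsrc : (∫ r in t..s, ((((g * α ^ 2 : ℝ) : ℂ) • (L ∘L propSin μ₁ (r - t)).toLinearMap
        + ((g * β ^ 2 : ℝ) : ℂ) • (L ∘L propSin μ₂ (r - t)).toLinearMap)
          (propSin (mE ^ 2) (s - r) f)))
        = g * ∫ r in t..s, (((α ^ 2 : ℝ) : ℂ) * L (propSin μ₁ (r - t) (propSin (mE ^ 2) (s - r) f))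
          + ((β ^ 2 : ℝ) : ℂ) * L (propSin μ₂ (r - t) (propSin (mE ^ 2) (s - r) f))) := by
      rw [← intervalIntegral.integral_const_mul]
      refine intervalIntegral.integral_congr fun r _ => ?_
      simp
      ring
    rw [hsrc] at hduh
    simp only [LinearMap.add_apply, LinearMap.smul_apply, ContinuousLinearMap.coe_coe,
      ContinuousLinearMap.comp_apply, smul_eq_mul, sub_self, propSin_zero, propCos_zero,
      map_zero, mul_zero, add_zero] at hduh ⊢
    push_cast at hduh ⊢
    linear_combination (-(g : ℂ)) * hduh
  · simp only [hw]; simp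
  · simp only [hp]
    have : (α : ℂ) ^ 2 + (β : ℂ) ^ 2 = 1 := by exact_mod_cast hr.norm
    have hLf : L f = ∫ x, f x * h x := smear_apply h f
    simp only [sub_self, propCos_zero, hLf]
    push_cast
    rw [← add_mul, this, one_mul]

/-! ### Uniqueness for the causal Volterra equation -/

/-- Fubini on the square for `k` extended by zero outside the triangle `q ≤ r`. -/
lemma integral_triangle_swap {k : ℝ → ℝ → ℂ} (hk : Continuous (Function.uncurry k)) {t s : ℝ}
    (hts : t ≤ s) :
    ∫ r in t..s, ∫ q in t..r, k r q = ∫ q in t..s, ∫ r in q..s, k r q := by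
  have hint : IntegrableOn (Function.uncurry fun r q => indicator {p : ℝ × ℝ | p.2 ≤ p.1}
      (Function.uncurry k) (r, q)) (uIoc t s ×ˢ uIoc t s) := by
    have h1 : IntegrableOn (Function.uncurry k) (uIcc t s ×ˢ uIcc t s) :=
      hk.continuousOn.integrableOn_compact (isCompact_uIcc.prod isCompact_uIcc)
    have h2 := h1.mono_set (prod_mono uIoc_subset_uIcc uIoc_subset_uIcc)
    exact h2.indicator (measurableSet_le measurable_snd measurable_fst)
  have key := intervalIntegral_intervalIntegral_swap hint
  have e1 : ∀ r ∈ uIcc t s, ∫ q in t..s, indicator {p : ℝ × ℝ | p.2 ≤ p.1}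
      (Function.uncurry k) (r, q) = ∫ q in t..r, k r q := by
    intro r hr
    rw [uIcc_of_le hts] at hr
    have : ∀ q, indicator {p : ℝ × ℝ | p.2 ≤ p.1} (Function.uncurry k) (r, q)
        = indicator (Iic r) (k r) q := fun q => rfl
    simp only [this]
    rw [intervalIntegral.integral_of_le hts, intervalIntegral.integral_of_le hr.1,
      setIntegral_indicator measurableSet_Iic, Ioc_inter_Iic, min_eq_right hr.2]
  have e2 : ∀ q ∈ uIcc t s, ∫ r in t..s, indicator {p : ℝ × ℝ | p.2 ≤ p.1}
      (Function.uncurry k) (r, q) = ∫ r in q..s, k r q := by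
    intro q hq
    rw [uIcc_of_le hts] at hq
    have : ∀ r, indicator {p : ℝ × ℝ | p.2 ≤ p.1} (Function.uncurry k) (r, q)
        = indicator (Ici q) (fun r => k r q) r := fun r => rfl
    simp only [this]
    rw [intervalIntegral.integral_of_le hts, intervalIntegral.integral_of_le hq.2,
      setIntegral_indicator measurableSet_Ici]
    refine setIntegral_congr_set ?_
    have : (Ioc t s ∩ Ici q : Set ℝ) =ᵐ[volume] (Ioc t s ∩ Ioi q : Set ℝ) :=
      (ae_eq_refl _).inter Ioi_ae_eq_Ici.symm
    refine this.trans ?_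
    rw [Ioc_inter_Ioi, max_eq_right hq.1]
    rfl
  rw [← intervalIntegral.integral_congr e1, ← intervalIntegral.integral_congr e2]
  exact key

lemma propSin_comm (μ ν s t : ℝ) (f : 𝓢(Space, ℂ)) :
    propSin μ s (propSin ν t f) = propSin ν t (propSin μ s f) := by
  rw [propSin, propSin, ← multiplier_mul (hasTemperateGrowth_oscSin μ s)
    (hasTemperateGrowth_oscSin ν t), ← multiplier_mul (hasTemperateGrowth_oscSin ν t)
    (hasTemperateGrowth_oscSin μ s)]
  simp only [mul_comm]

lemma continuous_propSin_comp (μ : ℝ) {X : Type*} [TopologicalSpace X] {τ : X → ℝ}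
    {ψ : X → 𝓢(Space, ℂ)} (hτ : Continuous τ) (hψ : Continuous ψ) :
    Continuous fun x => propSin μ (τ x) (ψ x) := by
  have h : Continuous fun x => (τ x, ψ x) := hτ.prodMk hψ
  have h' := Continuous.comp (continuous_propSin μ) h
  rwa [Function.comp_def] at h'

lemma continuous_systemProp (α β μ₁ μ₂ : ℝ) (f : 𝓢(Space, ℂ)) :
    Continuous fun τ => systemProp α β μ₁ μ₂ τ f :=
  ((continuous_propSin_comp μ₁ continuous_id continuous_const).const_smul _).add
    ((continuous_propSin_comp μ₂ continuous_id continuous_const).const_smul _)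

lemma propSin_systemProp_comm (α β μ₁ μ₂ ν s t : ℝ) (f : 𝓢(Space, ℂ)) :
    propSin ν s (systemProp α β μ₁ μ₂ t f) = systemProp α β μ₁ μ₂ t (propSin ν s f) := by
  simp only [systemProp, add_apply, smul_apply, map_add, map_smul, propSin_comm ν]

section
variable {mS mE g α β μ₁ μ₂ : ℝ}

/-- The response of the environment to the system, in the decoupled modes. -/
lemma MassRotation.response (hr : MassRotation mS g mE α β μ₁ μ₂) (L : 𝓢(Space, ℂ) →L[ℂ] ℂ)
    (τ : ℝ) (f : 𝓢(Space, ℂ)) :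
    ((α * β : ℝ) : ℂ) * (L (propSin μ₁ τ f) - L (propSin μ₂ τ f))
      = -g * ∫ σ in (0 : ℝ)..τ, L (propSin mE σ (systemProp α β μ₁ μ₂ (τ - σ) f)) := by
  have hE := (weakKG_prop L μ₁ 0).superpose (weakKG_prop L μ₂ 0) (α * β) (-(α * β)) mE
  have e₃ : (μ₁ - mE) * (α * β) = g * α ^ 2 := by linear_combination (-α) * hr.eq₂
  have e₄ : (μ₂ - mE) * (-(α * β)) = g * β ^ 2 := by linear_combination β * hr.eq₄
  rw [e₃, e₄] at hE
  have hduh := hE.field_eq ordConnected_univ (mem_univ 0) (mem_univ τ) f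
  have hsub := intervalIntegral.integral_comp_sub_left (a := 0) (b := τ)
    (fun σ => L (propSin mE σ (systemProp α β μ₁ μ₂ (τ - σ) f))) τ
  simp only [sub_sub_cancel, sub_self, sub_zero] at hsub
  rw [← hsub, ← intervalIntegral.integral_const_mul]
  simp only [LinearMap.add_apply, LinearMap.smul_apply, ContinuousLinearMap.coe_coe,
      ContinuousLinearMap.comp_apply, smul_eq_mul, sub_self, sub_zero, propSin_zero, propCos_zero,
      map_zero, mul_zero, add_zero, zero_add] at hduh
  rw [show ((-(α * β) : ℝ) : ℂ) = -((α * β : ℝ) : ℂ) by push_cast; rfl, neg_mul, neg_mul,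
    add_neg_cancel, zero_sub, ← intervalIntegral.integral_neg] at hduh
  rw [mul_sub, sub_eq_add_neg, hduh]
  refine intervalIntegral.integral_congr fun r _ => ?_
  simp only [propSin_systemProp_comm]
  simp only [systemProp, add_apply, smul_apply, map_add, map_smul, smul_eq_mul]
  push_cast
  ring

lemma hasCurveDerivAt_systemProp (α β μ₁ μ₂ τ : ℝ) (f : 𝓢(Space, ℂ)) :
    HasCurveDerivAt (fun τ => systemProp α β μ₁ μ₂ τ f) (systemPropDeriv α β μ₁ μ₂ τ f) τ :=
  ((hasCurveDerivAt_propSin μ₁ τ f).const_smul _).add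
    ((hasCurveDerivAt_propSin μ₂ τ f).const_smul _)

lemma hasCurveDerivAt_systemPropDeriv (α β μ₁ μ₂ τ : ℝ) (f : 𝓢(Space, ℂ)) :
    HasCurveDerivAt (fun τ => systemPropDeriv α β μ₁ μ₂ τ f)
      (((α ^ 2 : ℝ) : ℂ) • kgOp μ₁ (propSin μ₁ τ f)
        + ((β ^ 2 : ℝ) : ℂ) • kgOp μ₂ (propSin μ₂ τ f)) τ := by
  simp only [kgOp_propSin]
  exact ((hasCurveDerivAt_propCos μ₁ τ f).const_smul _).add
    ((hasCurveDerivAt_propCos μ₂ τ f).const_smul _)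

/-- Solutions of the homogeneous causal Volterra equation with vanishing data vanish. -/
lemma MassRotation.eq_zero_of_memory (hr : MassRotation mS g mE α β μ₁ μ₂) {t : ℝ}
    {L P : ℝ → 𝓢(Space, ℂ) →L[ℂ] ℂ}
    (hL : ContinuousOn (fun q : ℝ × 𝓢(Space, ℂ) => L q.1 q.2) (Ici t ×ˢ univ))
    (hP : ContinuousOn (fun q : ℝ × 𝓢(Space, ℂ) => P q.1 q.2) (Ici t ×ˢ univ))
    (hLd : ∀ f, ∀ s ∈ Ici t, HasDerivWithinAt (fun r => L r f) (P s f) (Ici t) s)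
    (hPd : ∀ f, ∀ s ∈ Ici t, HasDerivWithinAt (fun r => P r f)
      (L s (kgOp mS f) + (g : ℂ) ^ 2 * ∫ r in t..s, L r (propSin mE (s - r) f)) (Ici t) s)
    (hL0 : ∀ f, L t f = 0) (hP0 : ∀ f, P t f = 0) {s : ℝ} (hs : t ≤ s) (f : 𝓢(Space, ℂ)) :
    L s f = 0 := by
  -- The dual solution: the explicit kernel applied to `f`, with `B 0 = 0` and velocity `A 0 = f`.
  -- Run backwards from `s`, it is paired with the unknown solution.
  set B := fun τ => systemProp α β μ₁ μ₂ τ f with hB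
  set A := fun τ => systemPropDeriv α β μ₁ μ₂ τ f with hA
  have hBc : Continuous B := continuous_systemProp α β μ₁ μ₂ f
  -- `L` is controlled only from time `t` on; the maximum makes `k` continuous on the whole plane
  -- without changing it where it is used.
  set k : ℝ → ℝ → ℂ := fun r q => L (max t q) (propSin mE (r - q) (B (s - r))) with hk
  have hkc : Continuous (Function.uncurry k) := by
    refine hL.comp_continuous (f := fun p : ℝ × ℝ =>
      (max t p.2, propSin mE (p.1 - p.2) (B (s - p.1)))) ?_ fun p =>
      ⟨mem_Ici.2 (le_max_left _ _), mem_univ _⟩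
    refine Continuous.prodMk (by fun_prop) ?_
    exact continuous_propSin_comp mE (by fun_prop) (hBc.comp (by fun_prop))
  set K₁ : ℝ → ℂ := fun r => ∫ q in t..r, k r q with hK₁
  set K₂ : ℝ → ℂ := fun q => ∫ r in q..s, k r q with hK₂
  have hK₁c : Continuous K₁ :=
    intervalIntegral.continuous_parametric_intervalIntegral_of_continuous hkc continuous_id
  have hK₂c : Continuous K₂ := by
    have : K₂ = fun q => -∫ r in s..q, k r q := by
      ext q; rw [← intervalIntegral.integral_symm]
    rw [this]
    refine (intervalIntegral.continuous_parametric_intervalIntegral_of_continuous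
      (f := fun q r => k r q) ?_ continuous_id).neg
    exact hkc.comp continuous_swap
  -- The memory of the unknown solution contributes `K₁`. The kernel solves the Volterra equation as
  -- well, and by `MassRotation.response` its memory contributes `K₂` with the opposite sign.
  have hG : ∀ r ∈ Ici t, HasDerivWithinAt (fun r => L r (A (s - r)) + P r (B (s - r)))
      ((g : ℂ) ^ 2 * (K₁ r - K₂ r)) (Ici t) r := by
    intro r hr'
    have h1 := hasDerivWithinAt_apply_curve (φ := fun r => (L r).toLinearMap) hL hr'
      (hLd _ r hr') (hasCurveDerivAt_systemPropDeriv α β μ₁ μ₂ (s - r) f).comp_const_sub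
    have h2 := hasDerivWithinAt_apply_curve (φ := fun r => (P r).toLinearMap) hP hr'
      (hPd _ r hr') (hasCurveDerivAt_systemProp α β μ₁ μ₂ (s - r) f).comp_const_sub
    refine (h1.add h2).congr_deriv ?_
    have hK₁r : K₁ r = ∫ q in t..r, L q (propSin mE (r - q) (B (s - r))) := by
      refine intervalIntegral.integral_congr fun q hq => ?_
      rw [uIcc_of_le hr'] at hq
      simp only [hk, max_eq_right hq.1]
    have hK₂r : g * K₂ r = -(((α * β : ℝ) : ℂ) * (L r (propSin μ₁ (s - r) f)
        - L r (propSin μ₂ (s - r) f))) := by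
      rw [hr.response (L r) (s - r) f]
      have := intervalIntegral.integral_comp_sub_right (a := r) (b := s)
        (fun σ => L r (propSin mE σ (systemProp α β μ₁ μ₂ (s - r - σ) f))) r
      rw [sub_self] at this
      rw [← this, neg_mul, neg_neg, hK₂]
      simp only [hk, hB, max_eq_right (mem_Ici.1 hr'), sub_sub_sub_cancel_right]
    have e₁ : ((μ₁ : ℂ) - mS) * α ^ 2 = g * (α * β) := by
      have : (μ₁ - mS) * α ^ 2 = g * (α * β) := by linear_combination (-α) * hr.eq₁
      exact_mod_cast this
    have e₂ : ((μ₂ : ℂ) - mS) * β ^ 2 = -(g * (α * β)) := by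
      have : (μ₂ - mS) * β ^ 2 = -(g * (α * β)) := by linear_combination β * hr.eq₃
      exact_mod_cast this
    rw [mul_sub, hK₁r, show (g : ℂ) ^ 2 * K₂ r = g * (g * K₂ r) by ring, hK₂r]
    simp only [hB, systemPropDeriv, systemProp, kgOp_apply, ContinuousLinearMap.coe_coe, add_apply,
      smul_apply, map_add, map_sub, map_neg, map_smul, smul_eq_mul]
    push_cast
    linear_combination L r (propSin μ₁ (s - r) f) * e₁ + L r (propSin μ₂ (s - r) f) * e₂
  have hsub : Icc t s ⊆ Ici t := Icc_subset_Ici_self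
  have key := intervalIntegral.integral_eq_sub_of_hasDeriv_right
    (a := t) (b := s) (f := fun r => L r (A (s - r)) + P r (B (s - r)))
    (f' := fun r => (g : ℂ) ^ 2 * (K₁ r - K₂ r))
    (by rw [uIcc_of_le hs]; exact fun r hr => ((hG r (hsub hr)).mono hsub).continuousWithinAt)
    (by
      rw [min_eq_left hs, max_eq_right hs]
      exact fun r hr => ((hG r hr.1.le).hasDerivAt (Ici_mem_nhds hr.1)).hasDerivWithinAt)
    (Continuous.intervalIntegrable (by fun_prop) _ _)
  -- `K₁` and `K₂` are the two partial integrals of `k` over the triangle `t ≤ q ≤ r ≤ s`, so their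
  -- total integrals agree. The pairing thus has equal values at `t`, where it is zero, and at `s`,
  -- where it is `L s f`.
  rw [intervalIntegral.integral_const_mul, intervalIntegral.integral_sub
    (hK₁c.intervalIntegrable _ _) (hK₂c.intervalIntegrable _ _),
    integral_triangle_swap hkc hs, sub_self, mul_zero] at key
  have hn : (α : ℂ) ^ 2 + (β : ℂ) ^ 2 = 1 := by exact_mod_cast hr.norm
  have hA0 : L s (A 0) = L s f := by
    simp only [hA, systemPropDeriv, add_apply, smul_apply, map_add, map_smul, propCos_zero,
      smul_eq_mul]
    push_cast
    rw [← add_mul, hn, one_mul]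
  have hB0 : B 0 = 0 := by simp [hB, systemProp]
  simp only [sub_self, hA0, hB0, hL0, hP0, map_zero, add_zero, sub_zero] at key
  exact key.symm

end

lemma IsCausalVolterraSolution.unique {mS mE g t : ℝ} {h : 𝓢(Space, ℂ)}
    {w w' : ℝ → 𝓢'(Space, ℂ)} (hw : IsCausalVolterraSolution mS mE g t h w)
    (hw' : IsCausalVolterraSolution mS mE g t h w') {s : ℝ} (hs : t ≤ s) : w s = w' s := by
  obtain ⟨α, β, μ₁, μ₂, hr⟩ := exists_massRotation (mS ^ 2) g (mE ^ 2)
  obtain ⟨p, hwc, hpc, hwd, hpd, hw0, hp0⟩ := hw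
  obtain ⟨p', hwc', hpc', hwd', hpd', hw0', hp0'⟩ := hw'
  have hcont : ∀ {u : ℝ → 𝓢'(Space, ℂ)}, ContinuousOn (fun q : ℝ × 𝓢(Space, ℂ) => u q.1 q.2)
      (Ici t ×ˢ univ) → ∀ (f : 𝓢(Space, ℂ)) (s : ℝ), IntervalIntegrable
        (fun r => u r (propSin (mE ^ 2) (s - r) f)) volume t (max t s) := by
    intro u hu f s
    refine ContinuousOn.intervalIntegrable ?_
    rw [uIcc_of_le (le_max_left t s)]
    have hc : Continuous fun r : ℝ => (r, propSin (mE ^ 2) (s - r) f) :=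
      continuous_id.prodMk (continuous_propSin_comp _ (by fun_prop) continuous_const)
    exact hu.comp hc.continuousOn fun r hr => ⟨hr.1, mem_univ _⟩
  have key : ∀ f, (distCLM (w s) - distCLM (w' s)) f = 0 := by
    refine hr.eq_zero_of_memory (L := fun s => distCLM (w s) - distCLM (w' s))
      (P := fun s => distCLM (p s) - distCLM (p' s)) (hwc.sub hwc') (hpc.sub hpc')
      (fun f s hs => (hwd f s hs).sub (hwd' f s hs)) (fun f s hs => ?_)
      (fun f => ?_) (fun f => ?_) hs
    · refine ((hpd f s hs).sub (hpd' f s hs)).congr_deriv ?_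
      have hm : ∀ u : ℝ → 𝓢'(Space, ℂ), ∫ r in Ici t, u r (memoryKernel mE g (s - r) f)
          = -(g : ℂ) ^ 2 * ∫ r in t..s, u r (propSin (mE ^ 2) (s - r) f) := fun u =>
        integral_memoryKernel mE g (fun r => (distCLM (u r)).toLinearMap) f hs
      have hi := hcont hwc f s
      have hi' := hcont hwc' f s
      rw [max_eq_right (mem_Ici.1 hs)] at hi hi'
      have hsub := intervalIntegral.integral_sub hi hi'
      rw [hm, hm, kgSpatial_eq]
      change _ = (w s (kgOp (mS ^ 2) f) - w' s (kgOp (mS ^ 2) f)) + (g : ℂ) ^ 2 *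
        ∫ r in t..s, (w r (propSin (mE ^ 2) (s - r) f) - w' r (propSin (mE ^ 2) (s - r) f))
      rw [hsub]
      ring
    · exact sub_eq_zero.2 ((hw0 f).trans (hw0' f).symm)
    · exact sub_eq_zero.2 ((hp0 f).trans (hp0' f).symm)
  ext f
  exact sub_eq_zero.1 (key f)

/-! ### Exponential weights -/

/-- A smooth substitute for the distance to `c`. -/
def smoothDist (ε : ℝ) (c x : Space) : ℝ := Real.sqrt (ε ^ 2 + ‖x - c‖ ^ 2)

lemma le_smoothDist (ε : ℝ) (c x : Space) : ‖x - c‖ ≤ smoothDist ε c x :=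
  Real.le_sqrt_of_sq_le (by nlinarith [sq_nonneg ε])

lemma smoothDist_le {ε : ℝ} (hε : 0 ≤ ε) (c x : Space) : smoothDist ε c x ≤ ε + ‖x - c‖ :=
  Real.sqrt_le_iff.2 ⟨by positivity, by nlinarith [norm_nonneg (x - c)]⟩

lemma smoothDist_pos {ε : ℝ} (hε : 0 < ε) (c x : Space) : 0 < smoothDist ε c x :=
  Real.sqrt_pos.2 (by positivity)

lemma hasTemperateGrowth_smoothDist {ε : ℝ} (hε : 0 < ε) (c : Space) :
    (smoothDist ε c).HasTemperateGrowth := by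
  have h1 : (fun x : Space => ε⁻¹ • (x - c)).HasTemperateGrowth := by fun_prop
  have h2 := (Function.hasTemperateGrowth_one_add_norm_sq_rpow Space (1 / 2)).comp h1
  have h3 := (Function.HasTemperateGrowth.const (E := Space) ε).mul h2
  refine (congrArg Function.HasTemperateGrowth (funext fun x => ?_)).mp h3
  simp only [smoothDist, Pi.mul_apply, Function.comp_apply, ← Real.sqrt_eq_rpow, norm_smul,
    norm_inv, Real.norm_eq_abs, abs_of_pos hε]
  calc ε * √(1 + (ε⁻¹ * ‖x - c‖) ^ 2) = √(ε ^ 2) * √(1 + (ε⁻¹ * ‖x - c‖) ^ 2) := by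
        rw [Real.sqrt_sq hε.le]
    _ = _ := by
        rw [← Real.sqrt_mul (by positivity)]
        congr 1
        field_simp

lemma hasFDerivAt_smoothDist {ε : ℝ} (hε : 0 < ε) (c x : Space) :
    HasFDerivAt (smoothDist ε c) (innerSL ℝ ((smoothDist ε c x)⁻¹ • (x - c))) x := by
  have h1 : HasFDerivAt (fun y : Space => y - c) (ContinuousLinearMap.id ℝ Space) x :=
    (hasFDerivAt_id x).sub_const c
  have h2 := (h1.norm_sq.const_add (ε ^ 2)).sqrt (by positivity)
  refine h2.congr_fderiv ?_
  ext v
  simp [smoothDist]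
  ring

/-- The weight `exp (-2 η |x - c|)`, smoothed at `c`. -/
def expWeight (ε η : ℝ) (c x : Space) : ℝ := Real.exp (-(2 * η) * smoothDist ε c x)

/-- A weight whose logarithmic gradient is bounded by `2 η`. -/
structure EikonalWeight (η : ℝ) (w : Space → ℝ) (p : Space → Space) : Prop where
  growth : w.HasTemperateGrowth
  nonneg : ∀ x, 0 ≤ w x
  hasFDerivAt : ∀ x, HasFDerivAt w (-(2 * η * w x) • innerSL ℝ (p x)) x
  norm_le : ∀ x, ‖p x‖ ≤ 1

/-- All derivatives of exp(-by) are bounded on the positive half-line, though not on the whole line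
when `b > 0`; positivity of `ψ` keeps the composition there. -/
lemma hasTemperateGrowth_exp_neg_comp {b : ℝ} (hb : 0 ≤ b) {ψ : Space → ℝ}
    (hψ : ψ.HasTemperateGrowth) (hpos : ∀ x, 0 < ψ x) :
    (fun x => Real.exp (-b * ψ x)).HasTemperateGrowth := by
  refine Function.HasTemperateGrowth.comp' (g := fun y => Real.exp (-b * y)) (t := Ioi 0) ?_
    isOpen_Ioi.uniqueDiffOn ?_ ?_ hψ
  · rintro _ ⟨x, rfl⟩
    exact hpos x
  · exact (by fun_prop : ContDiff ℝ _ fun y : ℝ => Real.exp (-b * y)).contDiffOn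
  · intro N
    refine ⟨0, (1 + b) ^ N, by positivity, fun n hn y hy => ?_⟩
    rw [iteratedFDerivWithin_of_isOpen n isOpen_Ioi hy, norm_iteratedFDeriv_eq_norm_iteratedDeriv,
      iteratedDeriv_exp_const_mul, pow_zero, mul_one, norm_mul, norm_pow, norm_neg,
      Real.norm_of_nonneg hb, Real.norm_of_nonneg (Real.exp_pos _).le]
    have h1 : Real.exp (-b * y) ≤ 1 := Real.exp_le_one_iff.2 (by nlinarith [mem_Ioi.1 hy])
    calc b ^ n * Real.exp (-b * y) ≤ b ^ n * 1 := by gcongr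
      _ ≤ (1 + b) ^ n := by rw [mul_one]; gcongr; linarith
      _ ≤ (1 + b) ^ N := pow_le_pow_right₀ (by linarith) hn

lemma eikonalWeight_expWeight {ε η : ℝ} (hε : 0 < ε) (hη : 0 ≤ η) (c : Space) :
    EikonalWeight η (expWeight ε η c) (fun x => (smoothDist ε c x)⁻¹ • (x - c)) where
  growth := hasTemperateGrowth_exp_neg_comp (by positivity) (hasTemperateGrowth_smoothDist hε c)
    (smoothDist_pos hε c)
  nonneg x := (Real.exp_pos _).le
  hasFDerivAt x := by
    refine (((hasFDerivAt_smoothDist hε c x).const_mul (-(2 * η))).exp).congr_fderiv ?_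
    rw [smul_smul]
    congr 1
    rw [expWeight]
    ring
  norm_le x := by
    rw [norm_smul, norm_inv, Real.norm_of_nonneg (smoothDist_pos hε c x).le,
      inv_mul_le_iff₀ (smoothDist_pos hε c x), mul_one]
    exact le_smoothDist ε c x

/-! ### Weighted energies -/

/-- The pairing `∫ w(x) ⟪f(x), h(x)⟫ dx` with the real inner product of `ℂ`. -/
def weightedInner (w : Space → ℝ) (f h : 𝓢(Space, ℂ)) : ℝ := ∫ x, w x * ⟪f x, h x⟫_ℝ

/-- Multiplication by a temperate weight, as a map to `L²`. -/
def weightL2 (w : Space → ℝ) : 𝓢(Space, ℂ) →L[ℂ] Lp ℂ 2 (volume : Measure Space) :=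
  SchwartzMap.toLpCLM ℂ ℂ 2 volume ∘L SchwartzMap.smulLeftCLM ℂ (fun x => ((w x : ℝ) : ℂ))

section
variable {w : Space → ℝ}

lemma weight_mul_inner (hw : w.HasTemperateGrowth) (f h : 𝓢(Space, ℂ)) (x : Space) : w x * ⟪f x, h x⟫_ℝ
    = RCLike.re ⟪f x, SchwartzMap.smulLeftCLM ℂ (fun x => ((w x : ℝ) : ℂ)) h x⟫_ℂ := by
  rw [SchwartzMap.smulLeftCLM_apply_apply (hasTemperateGrowth_ofReal_comp hw), inner_smul_right,
    Complex.inner]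
  simp

lemma integrable_inner_schwartz (f h : 𝓢(Space, ℂ)) : Integrable fun x => ⟪f x, h x⟫_ℂ :=
  (L2.integrable_inner (𝕜 := ℂ) (f.toLp 2 volume) (h.toLp 2 volume)).congr (by
    filter_upwards [f.coeFn_toLp 2 volume, h.coeFn_toLp 2 volume] with x hf hh
    rw [hf, hh])

lemma integrable_weightedInner (hw : w.HasTemperateGrowth) (f h : 𝓢(Space, ℂ)) :
    Integrable fun x => w x * ⟪f x, h x⟫_ℝ := by
  simp only [weight_mul_inner hw]
  exact (integrable_inner_schwartz _ _).re

lemma re_inner_weightL2 (hw : w.HasTemperateGrowth) (f h : 𝓢(Space, ℂ)) :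
    RCLike.re ⟪SchwartzMap.toLpCLM ℂ ℂ 2 volume f, weightL2 w h⟫_ℂ = weightedInner w f h := by
  rw [weightedInner]
  simp only [weight_mul_inner hw]
  rw [integral_re (integrable_inner_schwartz _ _)]
  congr 1
  exact SchwartzMap.inner_toL2_toL2_eq f _ volume

lemma weightedInner_comm (f h : 𝓢(Space, ℂ)) : weightedInner w f h = weightedInner w h f := by
  simp only [weightedInner, real_inner_comm]

/-- The weighted pairing is the real part of an L² inner product of continuous linear images of the
curve, to which the product rule applies. -/
lemma hasDerivAt_weightedInner_self (hw : w.HasTemperateGrowth) {ψ : ℝ → 𝓢(Space, ℂ)} {ψ' : 𝓢(Space, ℂ)} {t : ℝ}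
    (h : HasCurveDerivAt ψ ψ' t) :
    HasDerivAt (fun s => weightedInner w (ψ s) (ψ s)) (2 * weightedInner w (ψ t) ψ') t := by
  have h1 := h.hasDerivAt_clm (SchwartzMap.toLpCLM ℂ ℂ 2 volume)
  have h2 := h.hasDerivAt_clm (weightL2 w)
  have h3 := (Complex.reCLM.hasFDerivAt.comp_hasDerivAt t (h1.inner ℂ h2))
  have e : ∀ f h, Complex.reCLM ⟪SchwartzMap.toLpCLM ℂ ℂ 2 volume f, weightL2 w h⟫_ℂ
    = weightedInner w f h := re_inner_weightL2 hw
  refine (h3.congr_deriv ?_).congr_of_eventuallyEq (.of_forall fun s => ?_)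
  · rw [map_add, e, e, weightedInner_comm ψ']
    ring
  · exact (e _ _).symm

end

/-- The standard basis of space. -/
abbrev axis (i : Fin 3) : Space := EuclideanSpace.basisFun (Fin 3) ℝ i

/-- The weighted energy of Cauchy data. -/
def weightedEnergy (w : Space → ℝ) (u v : 𝓢(Space, ℂ)) : ℝ :=
  weightedInner w v v + ∑ i, weightedInner w (∂_{axis i} u) (∂_{axis i} u) + weightedInner w u u

lemma weightedInner_self_nonneg {w : Space → ℝ} (hw : ∀ x, 0 ≤ w x) (f : 𝓢(Space, ℂ)) :
    0 ≤ weightedInner w f f :=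
  integral_nonneg fun x => mul_nonneg (hw x) real_inner_self_nonneg

namespace EikonalWeight
variable {η : ℝ} {w : Space → ℝ} {p : Space → Space}

lemma lineDeriv_smul (W : EikonalWeight η w p) (v : 𝓢(Space, ℂ)) (i : Fin 3) (x : Space) :
    ∂_{axis i} (SchwartzMap.smulLeftCLM ℂ w v) x
      = w x • ∂_{axis i} v x - (2 * η * w x * p x i) • v x := by
  have h := ((W.hasFDerivAt x).smul (v.hasFDerivAt x)).fderiv
  rw [SchwartzMap.lineDerivOp_apply_eq_fderiv, SchwartzMap.smulLeftCLM_apply W.growth]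
  refine (congrArg (fun A : Space →L[ℝ] ℂ => A (axis i)) h).trans ?_
  have hp : ⟪p x, axis i⟫_ℝ = p x i := by
    simp [axis, EuclideanSpace.inner_single_right]
  simp only [add_apply, smul_apply, ContinuousLinearMap.smulRight_apply, innerSL_apply_apply, hp,
    smul_eq_mul, SchwartzMap.lineDerivOp_apply_eq_fderiv]
  rw [neg_mul, neg_smul, sub_eq_add_neg]

lemma integrable_inner_real (f h : 𝓢(Space, ℂ)) : Integrable fun x => ⟪f x, h x⟫_ℝ := by
  simpa using integrable_weightedInner (.const 1) f h

lemma flux_eq (W : EikonalWeight η w p) (v b : 𝓢(Space, ℂ)) (i : Fin 3) (x : Space) :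
    2 * η * w x * (p x i * ⟪v x, b x⟫_ℝ)
      = w x * ⟪∂_{axis i} v x, b x⟫_ℝ - ⟪∂_{axis i} (SchwartzMap.smulLeftCLM ℂ w v) x, b x⟫_ℝ := by
  rw [W.lineDeriv_smul, inner_sub_left, real_inner_smul_left, real_inner_smul_left]
  ring

lemma integrable_flux (W : EikonalWeight η w p) (v b : 𝓢(Space, ℂ)) (i : Fin 3) :
    Integrable fun x => 2 * η * w x * (p x i * ⟪v x, b x⟫_ℝ) := by
  simp only [W.flux_eq]
  exact (integrable_weightedInner W.growth _ _).sub (integrable_inner_real _ _)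

/-- Integration by parts with a weight. -/
lemma weightedInner_lineDeriv (W : EikonalWeight η w p) (v b : 𝓢(Space, ℂ)) (i : Fin 3) :
    weightedInner w v (∂_{axis i} b) + weightedInner w (∂_{axis i} v) b
      = ∫ x, 2 * η * w x * (p x i * ⟪v x, b x⟫_ℝ) := by
  have h : ∫ x, ⟪SchwartzMap.smulLeftCLM ℂ w v x, ∂_{axis i} b x⟫_ℝ
      = -∫ x, ⟪∂_{axis i} (SchwartzMap.smulLeftCLM ℂ w v) x, b x⟫_ℝ :=
    SchwartzMap.integral_bilinear_lineDerivOp_right_eq_neg_left (μ := volume) _ b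
      (innerSL ℝ (E := ℂ)) (axis i)
  simp only [SchwartzMap.smulLeftCLM_apply_apply W.growth, real_inner_smul_left] at h
  simp only [W.flux_eq]
  rw [integral_sub (integrable_weightedInner W.growth _ _) (integrable_inner_real _ _),
    weightedInner, h, weightedInner]
  ring

/-- Green's formula with a weight. -/
lemma weightedInner_laplacian (W : EikonalWeight η w p) (u v : 𝓢(Space, ℂ)) :
    weightedInner w v (Δ u) + ∑ i, weightedInner w (∂_{axis i} u) (∂_{axis i} v)
      = ∑ i, ∫ x, 2 * η * w x * (p x i * ⟪v x, ∂_{axis i} u x⟫_ℝ) := by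
  have hL : weightedInner w v (Δ u) = ∑ i, weightedInner w v (∂_{axis i} (∂_{axis i} u)) := by
    simp only [weightedInner]
    rw [← integral_finsetSum _ fun i _ => integrable_weightedInner W.growth _ _]
    refine integral_congr_ae (.of_forall fun x => ?_)
    simp only [SchwartzMap.laplacian_eq_sum (EuclideanSpace.basisFun (Fin 3) ℝ),
      sum_apply, inner_sum, Finset.mul_sum]
  simp only [← W.weightedInner_lineDeriv, hL, Finset.sum_add_distrib,
    weightedInner_comm (∂_{axis _} v)]

/-- Pointwise, `‖p‖ ≤ 1` bounds the energy flux by the energy density. The constant is thus exactly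
the decay rate 2η of the weight, which is why the propagation speed comes out as one. -/
lemma flux_le (W : EikonalWeight η w p) (hη : 0 ≤ η) (u v : 𝓢(Space, ℂ)) :
    2 * ∑ i, ∫ x, 2 * η * w x * (p x i * ⟪v x, ∂_{axis i} u x⟫_ℝ)
      ≤ 2 * η * (weightedInner w v v + ∑ i, weightedInner w (∂_{axis i} u) (∂_{axis i} u)) := by
  have hI := integrable_weightedInner W.growth
  simp only [weightedInner]
  rw [← integral_finsetSum _ fun i _ => W.integrable_flux _ _ i, ← integral_const_mul,
    ← integral_finsetSum _ fun i _ => hI _ _,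
    ← integral_add (hI _ _) (integrable_finsetSum _ fun i _ => hI _ _), ← integral_const_mul]
  refine integral_mono
    ((integrable_finsetSum _ fun i _ => W.integrable_flux _ _ i).const_mul _)
    (((hI _ _).add (integrable_finsetSum _ fun i _ => hI _ _)).const_mul _) fun x => ?_
  have hp : ∑ i, p x i ^ 2 ≤ 1 := by
    have h1 := EuclideanSpace.real_norm_sq_eq (p x)
    rw [← h1]
    exact pow_le_one₀ (norm_nonneg _) (W.norm_le x)
  have hterm : ∀ i, 2 * (p x i * ⟪v x, ∂_{axis i} u x⟫_ℝ)
      ≤ p x i ^ 2 * ⟪v x, v x⟫_ℝ + ⟪∂_{axis i} u x, ∂_{axis i} u x⟫_ℝ := fun i => by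
    have h1 := real_inner_self_nonneg (x := p x i • v x - ∂_{axis i} u x)
    rw [real_inner_sub_sub_self, real_inner_smul_left, real_inner_smul_left,
      real_inner_smul_right] at h1
    linarith
  have hsum : 2 * ∑ i, p x i * ⟪v x, ∂_{axis i} u x⟫_ℝ
      ≤ ⟪v x, v x⟫_ℝ + ∑ i, ⟪∂_{axis i} u x, ∂_{axis i} u x⟫_ℝ := by
    rw [Finset.mul_sum]
    refine (Finset.sum_le_sum fun i _ => hterm i).trans ?_
    rw [Finset.sum_add_distrib, ← Finset.sum_mul]
    have h2 := mul_le_of_le_one_left (real_inner_self_nonneg (x := v x)) hp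
    linarith
  have hc : 0 ≤ 2 * η * w x := by have := W.nonneg x; positivity
  simp only [← Finset.mul_sum]
  linarith [mul_le_mul_of_nonneg_left hsum hc]

lemma two_weightedInner_le (W : EikonalWeight η w p) (a : ℝ) (u v : 𝓢(Space, ℂ)) :
    2 * a * weightedInner w u v ≤ |a| * (weightedInner w u u + weightedInner w v v) := by
  have hI := integrable_weightedInner W.growth
  simp only [weightedInner]
  rw [← integral_add (hI _ _) (hI _ _), ← integral_const_mul, ← integral_const_mul]
  refine integral_mono ((hI _ _).const_mul _) (((hI _ _).add (hI _ _)).const_mul _) fun x => ?_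
  have h1 : |2 * ⟪u x, v x⟫_ℝ| ≤ ⟪u x, u x⟫_ℝ + ⟪v x, v x⟫_ℝ := by
    rw [abs_le]
    constructor
    · have := real_inner_self_nonneg (x := u x + v x)
      rw [real_inner_add_add_self] at this
      linarith
    · have := real_inner_self_nonneg (x := u x - v x)
      rw [real_inner_sub_sub_self] at this
      linarith
  have h2 : a * (2 * ⟪u x, v x⟫_ℝ) ≤ |a| * (⟪u x, u x⟫_ℝ + ⟪v x, v x⟫_ℝ) := by
    refine (le_abs_self _).trans ?_
    rw [abs_mul]
    gcongr
  have := mul_le_mul_of_nonneg_left h2 (W.nonneg x)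
  simp only
  linarith

/-- The energy inequality. -/
lemma energy_inequality (W : EikonalWeight η w p) (hη : 0 ≤ η) (μ : ℝ) (u v : 𝓢(Space, ℂ)) :
    2 * weightedInner w v (kgOp μ u)
      + ∑ i, 2 * weightedInner w (∂_{axis i} u) (∂_{axis i} v) + 2 * weightedInner w u v
      ≤ (2 * η + |1 - μ|) * weightedEnergy w u v := by
  -- The energy carries squared mass 1 instead of `μ`, so that it is nonnegative for every real `μ`.
  -- The discrepancy `1 - μ` only enters the growth rate, independently of `η`.
  have hkg : weightedInner w v (kgOp μ u) = weightedInner w v (Δ u) - μ * weightedInner w u v := by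
    have hI := integrable_weightedInner W.growth
    rw [weightedInner_comm u, weightedInner, weightedInner, weightedInner, ← integral_const_mul,
      ← integral_sub (hI _ _) ((hI _ _).const_mul _)]
    refine integral_congr_ae (.of_forall fun x => ?_)
    simp only [kgOp_apply, sub_apply, smul_apply, inner_sub_right, Complex.coe_smul,
      real_inner_smul_right]
    ring
  have h1 := W.flux_le hη u v
  rw [← W.weightedInner_laplacian] at h1
  have h2 := W.two_weightedInner_le (1 - μ) u v
  have h3 := weightedInner_self_nonneg W.nonneg u
  have h4 := Finset.sum_nonneg fun i (_ : i ∈ Finset.univ) =>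
    weightedInner_self_nonneg W.nonneg (∂_{axis i} u)
  rw [hkg, weightedEnergy, ← Finset.mul_sum]
  nlinarith [mul_nonneg (abs_nonneg (1 - μ)) h4, mul_nonneg hη h3]

lemma hasDerivAt_energy (W : EikonalWeight η w p) {μ t : ℝ} {u v : ℝ → 𝓢(Space, ℂ)}
    (hu : HasCurveDerivAt u (v t) t) (hv : HasCurveDerivAt v (kgOp μ (u t)) t) :
    HasDerivAt (fun s => weightedEnergy w (u s) (v s))
      (2 * weightedInner w (v t) (kgOp μ (u t))
      + ∑ i, 2 * weightedInner w (∂_{axis i} (u t)) (∂_{axis i} (v t))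
      + 2 * weightedInner w (u t) (v t)) t :=
  ((hasDerivAt_weightedInner_self W.growth hv).add
    (HasDerivAt.fun_sum fun i _ => hasDerivAt_weightedInner_self W.growth
      (hu.clm_apply (lineDerivOpCLM ℂ 𝓢(Space, ℂ) (axis i))))).add
    (hasDerivAt_weightedInner_self W.growth hu)

/-- Weighted energies grow at most exponentially. -/
lemma energy_growth (W : EikonalWeight η w p) (hη : 0 ≤ η) {μ : ℝ} {u v : ℝ → 𝓢(Space, ℂ)}
    (hu : ∀ t, HasCurveDerivAt u (v t) t) (hv : ∀ t, HasCurveDerivAt v (kgOp μ (u t)) t)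
    {τ : ℝ} (hτ : 0 ≤ τ) : weightedEnergy w (u τ) (v τ)
      ≤ Real.exp ((2 * η + |1 - μ|) * τ) * weightedEnergy w (u 0) (v 0) := by
  set K := 2 * η + |1 - μ|
  have hd : ∀ t, HasDerivAt
      (fun s => Real.exp (-K * s) * weightedEnergy w (u s) (v s)) _ t := fun t =>
    (((hasDerivAt_id t).const_mul (-K)).exp).mul (W.hasDerivAt_energy (hu t) (hv t))
  have hanti := antitone_of_hasDerivAt_nonpos hd fun t => by
    have h1 := W.energy_inequality hη μ (u t) (v t)
    have h2 := Real.exp_pos (-K * t)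
    have h3 := mul_le_mul_of_nonneg_left h1 h2.le
    simp only [id_eq, mul_one, Pi.zero_apply]
    linarith
  have h := hanti hτ
  simp only [mul_zero, Real.exp_zero, one_mul] at h
  have h3 : Real.exp (K * τ) * Real.exp (-K * τ) = 1 := by rw [← Real.exp_add]; simp
  calc _ = Real.exp (K * τ) * (Real.exp (-K * τ) * weightedEnergy w (u τ) (v τ)) := by
        rw [← mul_assoc, h3, one_mul]
    _ ≤ _ := by gcongr

lemma propSin_growth (W : EikonalWeight η w p) (hη : 0 ≤ η) (μ : ℝ) (f : 𝓢(Space, ℂ))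
    {τ : ℝ} (hτ : 0 ≤ τ) : weightedInner w (propSin μ τ f) (propSin μ τ f)
      ≤ Real.exp ((2 * η + |1 - μ|) * τ) * weightedInner w f f := by
  have h := W.energy_growth hη (μ := μ) (u := fun s => propSin μ s f) (v := fun s => propCos μ s f)
    (fun t => hasCurveDerivAt_propSin μ t f)
    (fun t => by rw [kgOp_propSin]; exact hasCurveDerivAt_propCos μ t f) hτ
  have h0 : weightedEnergy w (propSin μ 0 f) (propCos μ 0 f) = weightedInner w f f := by
    simp [weightedEnergy, weightedInner]
  rw [h0] at h
  refine le_trans ?_ h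
  have h1 := weightedInner_self_nonneg W.nonneg (propCos μ τ f)
  have h2 := Finset.sum_nonneg fun i (_ : i ∈ Finset.univ) =>
    weightedInner_self_nonneg W.nonneg (∂_{axis i} (propSin μ τ f))
  simp only [weightedEnergy]
  linarith

end EikonalWeight

/-! ### Finite propagation speed -/

/-- A weight centred at `c` is at most exp(-2ηR) on the support of `f`, and the weighted energy
gains at most exp((2η + |1 - μ|)τ). A nonzero value at `c` would keep the weighted norm above a
multiple of exp(-4ηκ), which is impossible for large `η` because R - τ = 3κ > 2κ. -/
lemma propSin_eq_zero {μ τ : ℝ} (hτ : 0 ≤ τ) {f : 𝓢(Space, ℂ)} {c : Space}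
    (hc : ∀ y ∈ tsupport f, τ < dist c y) : propSin μ τ f c = 0 := by
  by_contra hne
  have hf : (tsupport f).Nonempty := by
    by_contra h
    rw [not_nonempty_iff_eq_empty, tsupport_eq_empty_iff] at h
    have : f = 0 := DFunLike.coe_injective h
    exact hne (by simp [this])
  -- The distance to the support is attained, so the pointwise strict inequality gives a uniform
  -- gap.
  obtain ⟨y₀, hy₀, hR⟩ := (isClosed_tsupport f).exists_infDist_eq_dist hf c
  set R := Metric.infDist c (tsupport f) with hRdef
  have hτR : τ < R := hR ▸ hc y₀ hy₀
  -- One third of the gap pays for smoothing the weight at `c`, one for the radius of the ball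
  -- around `c`, and one remains as gain.
  set κ := (R - τ) / 3 with hκ
  have hκ0 : 0 < κ := by rw [hκ]; linarith
  set u := propSin μ τ f with hu
  set m := ‖u c‖ / 2 with hm
  have hm0 : 0 < m := by have := norm_pos_iff.2 hne; positivity
  obtain ⟨δ, hδ, hball⟩ : ∃ δ > 0, ∀ x ∈ Metric.ball c δ, m < ‖u x‖ := by
    have : ∀ᶠ x in 𝓝 c, m < ‖u x‖ :=
      (u.continuous.norm.tendsto c).eventually (lt_mem_nhds (by rw [hm]; linarith))
    exact Metric.eventually_nhds_iff_ball.1 this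
  set ρ := min δ κ with hρ
  have hρ0 : 0 < ρ := lt_min hδ hκ0
  set V := volume.real (Metric.ball c ρ) with hV
  have hV0 : 0 < V := ENNReal.toReal_pos (Metric.measure_ball_pos volume c hρ0).ne'
    measure_ball_lt_top.ne
  set N := Real.exp (|1 - μ| * τ) * ∫ x, ⟪f x, f x⟫_ℝ with hN
  have key : ∀ η, 0 ≤ η → Real.exp (2 * η * κ) * (m ^ 2 * V) ≤ N := by
    intro η hη
    have W := eikonalWeight_expWeight hκ0 hη c
    have hgrow := W.propSin_growth hη μ f hτ
    have hupper : weightedInner (expWeight κ η c) f f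
        ≤ Real.exp (-(2 * η) * R) * ∫ x, ⟪f x, f x⟫_ℝ := by
      rw [weightedInner, ← integral_const_mul]
      refine integral_mono (integrable_weightedInner W.growth _ _)
        ((EikonalWeight.integrable_inner_real _ _).const_mul _) fun x => ?_
      by_cases hx : x ∈ tsupport f
      · refine mul_le_mul_of_nonneg_right ?_ real_inner_self_nonneg
        refine Real.exp_le_exp.2 (mul_le_mul_of_nonpos_left ?_ (by linarith))
        refine (Metric.infDist_le_dist_of_mem hx).trans ?_
        rw [dist_comm, dist_eq_norm]
        exact le_smoothDist κ c x
      · simp [image_eq_zero_of_notMem_tsupport hx]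
    have hlower : Real.exp (-(2 * η) * (2 * κ)) * (m ^ 2 * V)
        ≤ weightedInner (expWeight κ η c) u u := by
      have h1 : ∫ _ in Metric.ball c ρ, Real.exp (-(2 * η) * (2 * κ)) * m ^ 2
          ≤ ∫ x in Metric.ball c ρ, expWeight κ η c x * ⟪u x, u x⟫_ℝ := by
        refine setIntegral_mono_on (integrableOn_const measure_ball_lt_top.ne)
          (integrable_weightedInner W.growth _ _).integrableOn measurableSet_ball fun x hx => ?_
        have hxρ : ‖x - c‖ < ρ := by rwa [← dist_eq_norm]
        refine mul_le_mul ?_ ?_ (by positivity) (W.nonneg x)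
        · refine Real.exp_le_exp.2 (mul_le_mul_of_nonpos_left ?_ (by linarith))
          have := smoothDist_le hκ0.le c x
          have := min_le_right δ κ
          linarith
        · rw [real_inner_self_eq_norm_sq]
          have := hball x (Metric.ball_subset_ball (min_le_left _ _) hx)
          gcongr
      rw [setIntegral_const, smul_eq_mul] at h1
      refine le_trans (by rw [← hV] at h1; linarith) (setIntegral_le_integral
        (integrable_weightedInner W.growth _ _)
        (.of_forall fun x => mul_nonneg (W.nonneg x) real_inner_self_nonneg))
    have h2 := hlower.trans (hgrow.trans (mul_le_mul_of_nonneg_left hupper (Real.exp_pos _).le))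
    have h3 := mul_le_mul_of_nonneg_left h2 (Real.exp_pos (2 * η * (3 * κ))).le
    have e1 : Real.exp (2 * η * (3 * κ)) * (Real.exp (-(2 * η) * (2 * κ)) * (m ^ 2 * V))
        = Real.exp (2 * η * κ) * (m ^ 2 * V) := by
      rw [← mul_assoc, ← Real.exp_add]; congr 2; ring
    have e2 : Real.exp (2 * η * (3 * κ)) * (Real.exp ((2 * η + |1 - μ|) * τ)
        * (Real.exp (-(2 * η) * R) * ∫ x, ⟪f x, f x⟫_ℝ)) = N := by
      rw [hN, ← mul_assoc, ← mul_assoc, ← Real.exp_add, ← Real.exp_add]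
      congr 2
      rw [hκ]
      ring
    rwa [e1, e2] at h3
  have hM : 0 < m ^ 2 * V := by positivity
  have hN0 : 0 ≤ N := hM.le.trans (by simpa using key 0 le_rfl)
  -- This `η` makes the exponent equal to x = N / (m² V), so the bound reads exp x ≤ x and
  -- contradicts x + 1 ≤ exp x.
  have h := key (N / (m ^ 2 * V) / (2 * κ)) (by positivity)
  have e : 2 * (N / (m ^ 2 * V) / (2 * κ)) * κ = N / (m ^ 2 * V) := by field_simp
  rw [e, ← le_div_iff₀ hM] at h
  linarith [Real.add_one_le_exp (N / (m ^ 2 * V))]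

lemma propSin_eq_zero_of_abs_lt {μ τ : ℝ} {f : 𝓢(Space, ℂ)} {c : Space}
    (hc : ∀ y ∈ tsupport f, |τ| < dist c y) : propSin μ τ f c = 0 := by
  rcases le_total 0 τ with h | h
  · rw [abs_of_nonneg h] at hc
    exact propSin_eq_zero h hc
  · rw [abs_of_nonpos h] at hc
    have := propSin_eq_zero (μ := μ) (neg_nonneg.2 h) hc
    rw [propSin_neg] at this
    simpa using this

/-- Both modes propagate within the same light cone, since the speed does not depend on the squared
mass. -/
lemma causallySupported_commutatorFunction (α β μ₁ μ₂ : ℝ) :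
    CausallySupported (commutatorFunction α β μ₁ μ₂) := by
  intro s t f h hsupp
  rw [commutatorFunction_apply]
  refine integral_eq_zero_of_ae (.of_forall fun x => ?_)
  by_cases hx : x ∈ tsupport h
  · have h0 : ∀ μ, propSin μ (s - t) f x = 0 := fun μ => propSin_eq_zero_of_abs_lt fun y hy => by
      rw [dist_comm]
      exact hsupp y hy x hx
    simp [systemProp, h0]
  · simp [image_eq_zero_of_notMem_tsupport hx]

end LangevinCCR

end

/-! ### Assembly of the four statements -/

theorem mainTheorem3 {D : Type*} [NormedAddCommGroup D] [InnerProductSpace ℂ D]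
    (mS mE g t₀ : ℝ) (S E : LangevinCCR.ScalarField D)
    (hmodel : LangevinCCR.CoupledModel mS mE g t₀ S E) :
    LangevinCCR.SatisfiesLangevin mS mE g t₀ S E ∧
    (∃ ΔS : ℝ → ℝ → 𝓢(LangevinCCR.Space, ℂ) →L[ℂ] 𝓢'(LangevinCCR.Space, ℂ),
      (∀ (s t : ℝ) (f h : 𝓢(LangevinCCR.Space, ℂ)),
        Complex.I • ⁅S.field s f, S.field t h⁆ = (ΔS s t h f) • (1 : Module.End ℂ D)) ∧
      (∀ (t : ℝ) (h : 𝓢(LangevinCCR.Space, ℂ)),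
        LangevinCCR.IsCausalVolterraSolution mS mE g t h (fun s => ΔS s t h)) ∧
      (∀ (t : ℝ) (h : 𝓢(LangevinCCR.Space, ℂ)) (w : ℝ → 𝓢'(LangevinCCR.Space, ℂ)),
        LangevinCCR.IsCausalVolterraSolution mS mE g t h w → ∀ s, t ≤ s → w s = ΔS s t h) ∧
      LangevinCCR.CausallySupported ΔS) ∧
    (∀ t : ℝ, LangevinCCR.EqualTimeCCR S t) := by
  -- Any diagonalizing rotation serves to define the kernel `ΔS`; it depends only on the masses and
  -- the coupling, not on the fields.
  obtain ⟨α, β, μ₁, μ₂, hr⟩ := LangevinCCR.exists_massRotation (mS ^ 2) g (mE ^ 2)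
  refine ⟨hmodel.satisfiesLangevin, ⟨LangevinCCR.commutatorFunction α β μ₁ μ₂, fun s t f h => ?_,
    fun t h => hr.isCausalVolterraSolution t h,
    fun t h w hw s hs => hw.unique (hr.isCausalVolterraSolution t h) hs,
    LangevinCCR.causallySupported_commutatorFunction α β μ₁ μ₂⟩, hmodel.equalTimeCCR⟩
  rw [LangevinCCR.commutatorFunction_apply]
  exact hmodel.commutator hr s t f h
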